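/- Theorem 4.1. Let $d$ be an integer with $1\le d\le 5$ and let $G=(V,E)$ be a finite simple graph. A graph $K$ with vertex set $V$ is called $d$-sparse if every $X\subseteq V$ with $|X|\ge d$ satisfies $i_K(X)\le d|X|-\binom{d+1}{2}$, where $i_K(X)$ is the number of edges of $K$ with both ends in $X$. Let $R_d(G)$ be the $|E|\times d|V|$ rigidity matrix of $G$: the coordinates of the points $p(v)=(p_1(v),\dots,p_d(v))$, $v\in V$, are independent indeterminates over $\mathbb Q$, and the row of an edge $uv$ has the entries of $p(u)-p(v)$ in the $d$ columns of $u$, those of $p(v)-p(u)$ in the $d$ columns of $v$, and $0$ elsewhere. Let $r_d(G)$ be the rank of $R_d(G)$ over the field of rational functions in these indeterminates (that is, the rank of the generic $d$-dimensional rigidity matroid of $G$). Let $H=(V,F)$ be a maximal $d$-sparse subgraph of $G$, that is, $F\subseteq E$, $H$ is $d$-sparse, and no $d$-sparse graph $(V,F')$ has $F\subsetneq F'\subseteq E$. Then $$r_d(G)\le |F|.$$ Moreover, if $|V|\ge d$ and $G$ is generically rigid in $\mathbb R^d$, then $$|F|=d|V|-\binom{d+1}{2}.$$ Here a framework $(G,p)$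 with $p:V\to\mathbb R^d$ is rigid if every continuous motion $q:[0,1]\to(\mathbb R^d)^V$ with $q(0)=p$ that keeps $\|q_t(u)-q_t(v)\|=\|p(u)-p(v)\|$ for all $uv\in E$ and $t\in[0,1]$ also does so for all $u,v\in V$ and $t\in[0,1]$. The graph $G$ is generically rigid in $\mathbb R^d$ if $(G,p)$ is rigid for some $p$ whose $d|V|$ coordinates are algebraically independent over $\mathbb Q$. -/

import Mathlib

namespace BarJoint

/-- The number `i_H(X)` of edges of `H` joining pairs of vertices of `X`. -/
noncomputable def inducedEdgeCount {V : Type*} (H : SimpleGraph V) (X : Finset V) : ℕ :=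
  {e ∈ H.edgeSet | ∀ v ∈ e, v ∈ X}.ncard

/-- `H` is `d`-sparse: every set `X` of at least `d` vertices induces at most
`d |X| - (d+1 choose 2)` edges. -/
def IsSparse {V : Type*} (d : ℕ) (H : SimpleGraph V) : Prop :=
  ∀ X : Finset V, d ≤ X.card →
    (inducedEdgeCount H X : ℤ) ≤ (d : ℤ) * (X.card : ℤ) - ((d + 1).choose 2 : ℤ)

/-- `H` (a spanning subgraph, so given by its edge set) is a maximal `d`-sparse subgraph of `G`. -/
def IsMaximalSparseSubgraph {V : Type*} (d : ℕ) (G H : SimpleGraph V) : Prop :=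
  Maximal (fun K : SimpleGraph V => K ≤ G ∧ IsSparse d K) H

/-- The rigidity matrix of the framework `(G, p)` with coordinates in a commutative ring `K`.
The row of the edge `uv` has the entries of `p u - p v` in the columns of `u`, those of `p v - p u`
in the columns of `v`, and zeros elsewhere. (An edge has `u ≠ v`, so that at most one of the two
summands below is nonzero; their sum does not depend on the order of `u` and `v`.) -/
def rigidityMatrix {V : Type*} [DecidableEq V] {d : ℕ} {K : Type*} [CommRing K]
    (G : SimpleGraph V) (p : V → Fin d → K) : Matrix G.edgeSet (V × Fin d) K :=
  Matrix.of fun e wi =>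
    Sym2.lift ⟨fun u v : V =>
      (if wi.1 = u then p u wi.2 - p v wi.2 else 0) +
        (if wi.1 = v then p v wi.2 - p u wi.2 else 0),
      fun _ _ => add_comm _ _⟩ (e : Sym2 V)

/-- The field of rational functions over `ℚ` in one indeterminate for each coordinate of each
vertex. -/
abbrev CoordField (V : Type*) (d : ℕ) : Type _ :=
  FractionRing (MvPolynomial (V × Fin d) ℚ)

/-- The placement of `V` in `d`-space whose coordinates are independent indeterminates. -/
noncomputable def indeterminatePlacement (V : Type*) (d : ℕ) : V → Fin d → CoordField V d :=
  fun v i => algebraMap (MvPolynomial (V × Fin d) ℚ) (CoordField V d) (MvPolynomial.X (v, i))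

/-- `r_d(G)`: the rank of the rigidity matrix of `G` with indeterminate coordinates, which is the
rank of the `d`-dimensional generic rigidity matroid of `G`. -/
noncomputable def rigidityRank {V : Type*} [Fintype V] [DecidableEq V]
    (d : ℕ) (G : SimpleGraph V) : ℕ :=
  (rigidityMatrix G (indeterminatePlacement V d)).rank

/-- The placement `p` is generic: there are no algebraic dependencies (over `ℚ`) between the
coordinates of the points `p v`. -/
def IsGenericPlacement {V : Type*} {d : ℕ} (p : V → EuclideanSpace ℝ (Fin d)) : Prop :=
  AlgebraicIndependent ℚ (fun vi : V × Fin d => p vi.1 vi.2)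

/-- The framework `(G, p)` is rigid: every continuous motion of the points `p v` which preserves
the distances along the edges of `G` preserves the distances between all pairs of vertices. -/
def IsRigid {V : Type*} {d : ℕ} (G : SimpleGraph V) (p : V → EuclideanSpace ℝ (Fin d)) : Prop :=
  ∀ q : unitInterval → V → EuclideanSpace ℝ (Fin d), Continuous q → q 0 = p →
    (∀ t u v, G.Adj u v → dist (q t u) (q t v) = dist (p u) (p v)) →
    ∀ t u v, dist (q t u) (q t v) = dist (p u) (p v)

/-- `G` is generically rigid in `ℝ^d`: it has a rigid generic realisation in `ℝ^d`. (Rigidity of a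
generic framework depends only on the graph, so `some` and `every` mean the same here; `some` is
the weaker demand.) -/
def IsGenericallyRigid {V : Type*} (d : ℕ) (G : SimpleGraph V) : Prop :=
  ∃ p : V → EuclideanSpace ℝ (Fin d), IsGenericPlacement p ∧ IsRigid G p

end BarJoint

/-! Rank bound. Two tight sets of `F` that meet in at least `d` vertices have a tight union, so
distinct maximal tight sets meet in fewer than `d` vertices. By maximality of `H`, every edge of `G`
outside `F` is induced by a maximal tight set. By subadditivity of rank, it suffices that the union
of the complete graphs on these sets has rank at most the number of edges of `F` in it
(`rowRank_biUnion_sym2_le`).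

This goes by induction on the family. A complete graph on a tight set `X` has rank equal to the
number of edges of `F` in `X`. Submodularity allows `X` to be removed once its edges shared with
other members are independent. If no such `X` exists, the shared edges of each `X` contain a
subgraph of minimum degree above `d` on some `Y X`, since otherwise peeling off vertices of degree
at most `d` would prove independence.

`HighDegreeFamily.eq_empty` excludes this by discharging. Each vertex splits weight 1 among the
members containing it, and each edge of `F` splits weight 1 equally among the members inducing it.
In every `X` the edge weight is at least `d` times the vertex weight: outside `Y X` by Hall's
theorem, inside `Y X` by the large degrees. Summing gives `d` times the size of the union as a lower
bound on its number of edges, against sparsity. The bound `d ≤ 5` enters in the inequality for the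
stars in `Y X`; vertices in exactly three members need an uneven split.

Rigid case. At a generic placement every infinitesimal motion extends to a curve preserving edge
lengths, so in a rigid framework it is trivial to first order on all pairs. Hence the rank of `G` is
at least that of the complete graph, and sparsity of `H` gives the opposite bound. -/

namespace BarJoint

open Finset

/-! ### Independent rows and the rank of complete graphs in general position -/

section RowRank

variable {V : Type*} [DecidableEq V] {d : ℕ} {K : Type*} [Field K]

/-- The row of the rigidity matrix which belongs to a pair of vertices. -/
def edgeRow {R : Type*} [CommRing R] (p : V → Fin d → R) (e : Sym2 V) (wi : V × Fin d) : R :=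
  Sym2.lift ⟨fun u v : V =>
    (if wi.1 = u then p u wi.2 - p v wi.2 else 0) +
      (if wi.1 = v then p v wi.2 - p u wi.2 else 0),
    fun _ _ => add_comm _ _⟩ e

theorem edgeRow_mk {R : Type*} [CommRing R] (p : V → Fin d → R) (u v w : V) (i : Fin d) :
    edgeRow p s(u, v) (w, i) =
      (if w = u then p u i - p v i else 0) + (if w = v then p v i - p u i else 0) := rfl

theorem edgeRow_diag (p : V → Fin d → K) (u : V) : edgeRow p s(u, u) = 0 := by
  ext ⟨w, i⟩
  simp [edgeRow_mk]

theorem edgeRow_eq_zero_of_notMem (p : V → Fin d → K) {e : Sym2 V} {w : V} (h : w ∉ e)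
    (i : Fin d) : edgeRow p e (w, i) = 0 := by
  induction e with
  | _ a b =>
    simp only [Sym2.mem_iff, not_or] at h
    simp [edgeRow_mk, h.1, h.2]

/-- Any `d + 1` of the points `p v` are affinely independent. -/
def InGeneralPosition (p : V → Fin d → K) : Prop :=
  ∀ s : Finset V, s.card ≤ d + 1 → ∀ c : V → K, ∑ v ∈ s, c v = 0 →
    (∀ i, ∑ v ∈ s, c v * p v i = 0) → ∀ v ∈ s, c v = 0

/-- An affine dependency would annihilate a square matrix of coordinate differences. Its determinant
is a nonzero polynomial in the coordinates, so it cannot vanish at algebraically independent values.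
-/
theorem inGeneralPosition_of_algebraicIndependent [Algebra ℚ K] {p : V → Fin d → K}
    (hp : AlgebraicIndependent ℚ (fun vi : V × Fin d => p vi.1 vi.2)) :
    InGeneralPosition p := by
  intro s hs c hc0 hc
  rcases s.eq_empty_or_nonempty with rfl | ⟨v₀, hv₀⟩
  · simp
  have hcard : (s.erase v₀).card ≤ d := by
    rw [card_erase_of_mem hv₀]; omega
  obtain ⟨f⟩ : Nonempty ((s.erase v₀ : Finset V) ↪ Fin d) := by
    apply Function.Embedding.nonempty_of_card_le
    simpa using hcard
  let M : Matrix (s.erase v₀ : Finset V) (s.erase v₀ : Finset V) (MvPolynomial (V × Fin d) ℚ) :=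
    Matrix.of fun u w => MvPolynomial.X ((u : V), f w) - MvPolynomial.X (v₀, f w)
  have hM : M.det ≠ 0 := by
    intro h0
    -- This specialisation puts `v₀` at the origin and the other points at distinct unit vectors,
    -- turning `M` into the identity.
    let x : V × Fin d → ℚ := fun vi => if ∃ h : vi.1 ∈ s.erase v₀, f ⟨vi.1, h⟩ = vi.2 then 1 else 0
    have h1 : (M.map (MvPolynomial.eval x)).det = 0 := by
      have := RingHom.map_det (MvPolynomial.eval x) M
      rw [h0, map_zero] at this
      exact this.symm
    have h2 : M.map (MvPolynomial.eval x) = 1 := by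
      ext u w
      have hu : (∃ h : (u : V) ∈ s.erase v₀, f ⟨u, h⟩ = f w) ↔ u = w :=
        ⟨fun ⟨_, h⟩ => f.injective h, fun h => ⟨u.2, congrArg f h⟩⟩
      have hv : ¬ ∃ h : v₀ ∈ s.erase v₀, f ⟨v₀, h⟩ = f w := fun ⟨h, _⟩ => notMem_erase _ _ h
      simp only [M, x, Matrix.map_apply, Matrix.of_apply, map_sub, MvPolynomial.eval_X,
        Matrix.one_apply]
      simp only [hu, hv, if_false, sub_zero]
    rw [h2, Matrix.det_one] at h1
    exact one_ne_zero h1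
  have hMp : (M.map (MvPolynomial.aeval (fun vi : V × Fin d => p vi.1 vi.2))).det ≠ 0 := by
    intro h0
    apply hM
    apply hp
    rw [map_zero, ← h0]
    exact AlgHom.map_det _ M
  have hsum : ∑ u ∈ s.erase v₀, c u = - c v₀ := by
    rw [← sum_erase_add _ _ hv₀] at hc0
    exact eq_neg_of_add_eq_zero_left hc0
  have hvec : Matrix.vecMul (fun u : (s.erase v₀ : Finset V) => c u)
      (M.map (MvPolynomial.aeval (fun vi : V × Fin d => p vi.1 vi.2))) = 0 := by
    ext w
    have := hc (f w)
    rw [← sum_erase_add _ _ hv₀] at this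
    simp only [Matrix.vecMul, dotProduct, M, Matrix.map_apply, Matrix.of_apply, map_sub,
      MvPolynomial.aeval_X, Pi.zero_apply]
    rw [sum_coe_sort (s.erase v₀) (fun u => c u * (p u (f w) - p v₀ (f w)))]
    simp only [mul_sub, sum_sub_distrib]
    rw [← sum_mul, hsum]
    linear_combination this
  have h3 := Matrix.eq_zero_of_vecMul_eq_zero hMp hvec
  have h4 : ∀ u ∈ s.erase v₀, c u = 0 := fun u hu => congrFun h3 ⟨u, hu⟩
  intro v hv
  by_cases hvv : v = v₀
  · subst hvv
    rw [sum_eq_zero h4] at hsum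
    exact neg_eq_zero.mp hsum.symm
  · exact h4 v (mem_erase.mpr ⟨hvv, hv⟩)

theorem filter_mem_inter_sym2 (T : Finset (Sym2 V)) (Y : Finset V) (v : V) (hv : v ∈ Y) :
    {e ∈ T ∩ Y.sym2 | v ∈ e} = {u ∈ Y | s(v, u) ∈ T}.image (fun u => s(v, u)) := by
  ext e
  simp only [mem_filter, mem_inter, mem_image, mem_sym2_iff]
  constructor
  · rintro ⟨⟨heT, heY⟩, hve⟩
    obtain ⟨u, rfl⟩ := hve
    exact ⟨u, ⟨heY u (by simp), heT⟩, rfl⟩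
  · rintro ⟨u, ⟨hu, huT⟩, rfl⟩
    refine ⟨⟨huT, ?_⟩, by simp⟩
    intro a ha
    rcases Sym2.mem_iff.mp ha with rfl | rfl <;> assumption

/-- If every nonempty set of vertices has a vertex at which it induces at most `d` edges of `T`,
then the rows of the edges in `T` are linearly independent. -/
theorem linearIndepOn_edgeRow [Fintype V] {p : V → Fin d → K} (hp : InGeneralPosition p)
    {T : Finset (Sym2 V)} (hT : ∀ e ∈ T, ¬ e.IsDiag)
    (h : ∀ Y : Finset V, Y.Nonempty → ∃ v ∈ Y, #{e ∈ T ∩ Y.sym2 | v ∈ e} ≤ d) :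
    LinearIndepOn K (edgeRow p) (T : Set (Sym2 V)) := by
  rw [linearIndepOn_finset_iff]
  intro g hg
  -- Vertices are peeled off one at a time. The columns of a vertex `v` with at most `d` edges give
  -- a relation between the vectors `p v - p u`, which general position forces to be trivial; then
  -- `v` can be deleted.
  suffices H : ∀ Y : Finset V, ∑ e ∈ T ∩ Y.sym2, g e • edgeRow p e = 0 →
      ∀ e ∈ T ∩ Y.sym2, g e = 0 by
    simpa using H univ (by simpa using hg)
  intro Y
  induction Y using Finset.strongInduction with
  | H Y ih =>
    intro hY
    rcases Y.eq_empty_or_nonempty with rfl | hne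
    · simp
    obtain ⟨v, hv, hdeg⟩ := h Y hne
    have himg := filter_mem_inter_sym2 T Y v hv
    have hinj : Function.Injective (fun u => s(v, u)) := fun a b hab => Sym2.congr_right.mp hab
    set N : Finset V := {u ∈ Y | s(v, u) ∈ T} with hN
    have hvN : v ∉ N := by
      intro hvN
      exact hT _ (mem_filter.mp hvN).2 (by simp)
    have hNd : N.card ≤ d := by
      rwa [himg, card_image_of_injective _ hinj] at hdeg
    have hcol : ∀ i, ∑ u ∈ N, g s(v, u) * (p v i - p u i) = 0 := by
      intro i
      have h1 := congrFun hY (v, i)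
      simp only [Finset.sum_apply, Pi.smul_apply, smul_eq_mul, Pi.zero_apply] at h1
      rw [← sum_filter_add_sum_filter_not _ (fun e => v ∈ e), himg,
        sum_image (fun a _ b _ hab => hinj hab)] at h1
      rw [sum_eq_zero (s := filter (fun e => v ∉ e) _), add_zero] at h1
      · rw [← h1]
        apply sum_congr rfl
        intro u hu
        have : v ≠ u := fun h => hvN (h ▸ hu)
        simp [edgeRow_mk, this]
      · intro e he
        rw [edgeRow_eq_zero_of_notMem p (mem_filter.mp he).2, mul_zero]
    have hneN : ∀ u ∈ N, u ≠ v := fun u hu h => hvN (h ▸ hu)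
    have hzero : ∀ u ∈ N, g s(v, u) = 0 := by
      -- The coefficient at `v` is chosen so that the relation between differences becomes an affine
      -- relation between points.
      have := hp (insert v N) (by rw [card_insert_of_notMem hvN]; omega)
        (fun u => if u = v then ∑ x ∈ N, g s(v, x) else - g s(v, u)) ?_ ?_
      · intro u hu
        have h2 := this u (mem_insert_of_mem hu)
        have : u ≠ v := fun h => hvN (h ▸ hu)
        simpa [this] using h2
      · rw [sum_insert hvN, if_pos rfl, sum_congr rfl fun u hu => if_neg (hneN u hu),
          sum_neg_distrib, add_neg_cancel]
      · intro i
        rw [sum_insert hvN, if_pos rfl, sum_mul, ← sum_add_distrib, ← hcol i]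
        refine sum_congr rfl fun u hu => ?_
        rw [if_neg (hneN u hu)]
        ring
    have hsplit : ∀ e ∈ T ∩ Y.sym2, v ∈ e → g e = 0 := by
      intro e he hve
      have : e ∈ {e ∈ T ∩ Y.sym2 | v ∈ e} := mem_filter.mpr ⟨he, hve⟩
      rw [himg] at this
      obtain ⟨u, hu, rfl⟩ := mem_image.mp this
      exact hzero u hu
    have hrest : {e ∈ T ∩ Y.sym2 | v ∉ e} = T ∩ (Y.erase v).sym2 := by
      ext e
      simp only [mem_filter, mem_inter, mem_sym2_iff, mem_erase, and_assoc]
      refine and_congr_right fun _ => ⟨fun ⟨h1, h2⟩ a ha => ⟨fun h => h2 (h ▸ ha), h1 a ha⟩,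
        fun h1 => ⟨fun a ha => (h1 a ha).2, fun h2 => (h1 v h2).1 rfl⟩⟩
    have hY' : ∑ e ∈ T ∩ (Y.erase v).sym2, g e • edgeRow p e = 0 := by
      rw [← sum_filter_add_sum_filter_not _ (fun e => v ∈ e), sum_eq_zero, zero_add, hrest] at hY
      · exact hY
      · intro e he
        rw [hsplit e (mem_filter.mp he).1 (mem_filter.mp he).2, zero_smul]
    intro e he
    by_cases hve : v ∈ e
    · exact hsplit e he hve
    · refine ih _ (erase_ssubset hv) hY' e ?_
      rw [← hrest]
      exact mem_filter.mpr ⟨he, hve⟩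

/-- The edges of the complete graph on `X` which meet `B`. -/
def joinEdges (B X : Finset V) : Finset (Sym2 V) :=
  {e ∈ X.sym2 | ¬ e.IsDiag ∧ ∃ v ∈ B, v ∈ e}

theorem mem_joinEdges {B X : Finset V} {a b : V} :
    s(a, b) ∈ joinEdges B X ↔ (a ∈ X ∧ b ∈ X) ∧ a ≠ b ∧ (a ∈ B ∨ b ∈ B) := by
  simp only [joinEdges, mem_filter, mk_mem_sym2_iff, Sym2.mk_isDiag_iff, Sym2.mem_iff]
  refine and_congr_right fun _ => and_congr_right fun _ => ?_
  constructor
  · rintro ⟨v, hv, rfl | rfl⟩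
    exacts [.inl hv, .inr hv]
  · rintro (h | h)
    exacts [⟨a, h, .inl rfl⟩, ⟨b, h, .inr rfl⟩]

theorem sym2_filter_not_isDiag_card (X : Finset V) :
    #{e ∈ X.sym2 | ¬ e.IsDiag} = X.card.choose 2 := by
  rw [← Sym2.card_image_offDiag]
  congr 1
  ext e
  induction e with
  | _ a b =>
    simp only [mem_filter, mk_mem_sym2_iff, Sym2.mk_isDiag_iff, mem_image, mem_offDiag]
    constructor
    · rintro ⟨⟨h1, h2⟩, h3⟩
      exact ⟨(a, b), ⟨h1, h2, h3⟩, rfl⟩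
    · rintro ⟨⟨x, y⟩, ⟨h1, h2, h3⟩, h4⟩
      rcases Sym2.eq_iff.mp h4 with ⟨rfl, rfl⟩ | ⟨rfl, rfl⟩
      exacts [⟨⟨h1, h2⟩, h3⟩, ⟨⟨h2, h1⟩, Ne.symm h3⟩]

theorem joinEdges_card {B X : Finset V} (hB : B ⊆ X) (hBd : B.card = d) :
    (joinEdges B X).card + (d + 1).choose 2 = d * X.card := by
  have h1 : #(joinEdges B X) + #{e ∈ (X \ B).sym2 | ¬ e.IsDiag} =
      #{e ∈ X.sym2 | ¬ e.IsDiag} := by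
    rw [← card_union_of_disjoint]
    · congr 1
      ext e
      induction e with
      | _ a b =>
        simp only [mem_union, mem_joinEdges, mem_filter, mk_mem_sym2_iff, mem_sdiff,
          Sym2.mk_isDiag_iff]
        tauto
    · rw [disjoint_left]
      intro e
      induction e with
      | _ a b =>
        simp only [mem_joinEdges, mem_filter, mk_mem_sym2_iff, mem_sdiff]
        tauto
  rw [sym2_filter_not_isDiag_card, sym2_filter_not_isDiag_card, card_sdiff_of_subset hB, hBd] at h1
  obtain ⟨m, hm⟩ := Nat.exists_eq_add_of_le (hBd ▸ card_le_card hB)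
  rw [hm] at h1 ⊢
  rw [Nat.add_sub_cancel_left] at h1
  have h2 : (d + m).choose 2 = d.choose 2 + d * m + m.choose 2 := by
    have := Nat.add_choose_eq d m 2
    rw [this]
    simp [Finset.Nat.antidiagonal_succ]
    ring
  have h3 : (d + 1).choose 2 = d.choose 2 + d := by
    rw [Nat.choose_succ_succ' d 1]; simp [add_comm]
  have h4 : d * d = 2 * d.choose 2 + d := by
    rcases d with _ | n
    · simp
    · have := Nat.even_mul_pred_self (n + 1)
      obtain ⟨k, hk⟩ := this
      simp only [Nat.add_sub_cancel] at *
      have : (n + 1) * n / 2 = k := by omega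
      rw [Nat.choose_two_right, Nat.add_sub_cancel, this]
      nlinarith
  rw [mul_add]
  omega

theorem exists_degree_joinEdges_le [Fintype V] {B X : Finset V} (hBd : B.card = d)
    (Y : Finset V) (hY : Y.Nonempty) :
    ∃ v ∈ Y, #{e ∈ joinEdges B X ∩ Y.sym2 | v ∈ e} ≤ d := by
  by_cases h : Y ⊆ B
  · obtain ⟨v, hv⟩ := hY
    refine ⟨v, hv, ?_⟩
    rw [filter_mem_inter_sym2 _ _ _ hv]
    refine card_image_le.trans ((card_le_card (filter_subset _ _)).trans ?_)
    exact (card_le_card h).trans hBd.le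
  · obtain ⟨v, hv, hvB⟩ := not_subset.mp h
    refine ⟨v, hv, ?_⟩
    rw [filter_mem_inter_sym2 _ _ _ hv]
    refine card_image_le.trans ((card_le_card ?_).trans hBd.le)
    intro u hu
    exact ((mem_joinEdges.mp (mem_filter.mp hu).2).2.2).resolve_left hvB

/-- The stress of a complete graph on affinely dependent points. -/
theorem sum_sum_edgeRow_eq_zero (p : V → Fin d → K) (S : Finset V) (c : V → K)
    (h0 : ∑ v ∈ S, c v = 0) (h : ∀ i, ∑ v ∈ S, c v * p v i = 0) :
    ∑ a ∈ S, ∑ b ∈ S, (c a * c b) • edgeRow p s(a, b) = 0 := by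
  ext ⟨w, i⟩
  have key : ∀ x : V, ∑ b ∈ S, c b * (p x i - p b i) = 0 := by
    intro x
    simp only [mul_sub, sum_sub_distrib, h, ← sum_mul, h0]
    simp
  simp only [Finset.sum_apply, Pi.smul_apply, edgeRow_mk, smul_eq_mul, mul_add,
    sum_add_distrib, Pi.zero_apply]
  rw [sum_comm (s := S) (t := S)
    (f := fun a b => c a * c b * if w = b then p b i - p a i else 0)]
  have h1 : ∀ a, ∑ b ∈ S, c a * c b * (if w = a then p a i - p b i else 0) = 0 := by
    intro a
    split_ifs
    · simp only [mul_assoc, ← mul_sum, key, mul_zero]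
    · simp
  have h2 : ∀ b, ∑ a ∈ S, c a * c b * (if w = b then p b i - p a i else 0) = 0 := by
    intro b
    refine Eq.trans ?_ (h1 b)
    exact sum_congr rfl fun a _ => by rw [mul_comm (c a)]
  simp only [h1, h2, sum_const_zero, add_zero]

theorem exists_affine_relation (p : V → Fin d → K) {S : Finset V} (hS : S.card = d + 2) :
    ∃ c : V → K, ∑ v ∈ S, c v = 0 ∧ (∀ i, ∑ v ∈ S, c v * p v i = 0) ∧ ∃ v ∈ S, c v ≠ 0 := by
  have h : ¬ LinearIndependent K (fun v : S => ((1 : K), p v)) := by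
    intro h
    have := h.fintype_card_le_finrank
    simp [hS] at this
    omega
  obtain ⟨g, hg, v, hv⟩ := Fintype.not_linearIndependent_iff.mp h
  refine ⟨fun v => if h : v ∈ S then g ⟨v, h⟩ else 0, ?_, ?_, v, v.2, by simpa using hv⟩
  · rw [← sum_coe_sort S]
    simpa [Prod.fst_sum] using congrArg Prod.fst hg
  · intro i
    rw [← sum_coe_sort S]
    simpa [Prod.snd_sum] using congrFun (congrArg Prod.snd hg) i

/-- For `u`, `v` outside `B`, the `d + 2` points of `B ∪ {u, v}` satisfy an affine relation `c`,
with all coefficients nonzero by general position. The stress `c a * c b` then expresses the row of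
`uv` through rows of pairs meeting `B`. -/
theorem edgeRow_mem_span_joinEdges [CharZero K] {p : V → Fin d → K} (hp : InGeneralPosition p)
    {B X : Finset V} (hB : B ⊆ X) (hBd : B.card = d) {e : Sym2 V} (he : e ∈ X.sym2) :
    edgeRow p e ∈ Submodule.span K (edgeRow p '' (joinEdges B X : Set (Sym2 V))) := by
  set W := Submodule.span K (edgeRow p '' (joinEdges B X : Set (Sym2 V))) with hW
  have hbase : ∀ a b, a ∈ X → b ∈ X → (a ∈ B ∨ b ∈ B) → edgeRow p s(a, b) ∈ W := by
    intro a b ha hb hab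
    by_cases h : a = b
    · subst h
      rw [edgeRow_diag]
      exact W.zero_mem
    · exact Submodule.subset_span ⟨_, mem_joinEdges.mpr ⟨⟨ha, hb⟩, h, hab⟩, rfl⟩
  induction e with
  | _ u v =>
    obtain ⟨hu, hv⟩ := mk_mem_sym2_iff.mp he
    by_cases hB' : u ∈ B ∨ v ∈ B
    · exact hbase u v hu hv hB'
    push Not at hB'
    obtain ⟨huB, hvB⟩ := hB'
    by_cases huv : u = v
    · subst huv
      rw [edgeRow_diag]
      exact W.zero_mem
    have hu' : u ∉ insert v B := by simp [huv, huB]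
    set S := insert u (insert v B) with hS
    have hScard : S.card = d + 2 := by
      rw [hS, card_insert_of_notMem hu', card_insert_of_notMem hvB, hBd]
    obtain ⟨c, hc0, hc, w, hw, hcw⟩ := exists_affine_relation p hScard
    have hne : ∀ x ∈ S, c x ≠ 0 := by
      intro x hx hcx
      have := hp (S.erase x) (by rw [card_erase_of_mem hx, hScard]; omega) c
        (by rw [← sum_erase_add _ _ hx, hcx, add_zero] at hc0; exact hc0)
        (fun i => by have := hc i; rw [← sum_erase_add _ _ hx, hcx, zero_mul, add_zero] at this
                     exact this)
      by_cases h : w = x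
      · exact hcw (h ▸ hcx)
      · exact hcw (this w (mem_erase.mpr ⟨h, hw⟩))
    have hsum := sum_sum_edgeRow_eq_zero p S c hc0 hc
    have hBW : ∀ a ∈ X, ∑ b ∈ B, (c a * c b) • edgeRow p s(a, b) ∈ W := fun a ha =>
      W.sum_mem fun b hb => W.smul_mem _ (hbase a b ha (hB hb) (.inr hb))
    have hBW' : ∑ a ∈ B, ∑ b ∈ S, (c a * c b) • edgeRow p s(a, b) ∈ W := by
      refine W.sum_mem fun a ha => W.sum_mem fun b hb => W.smul_mem _ ?_
      refine hbase a b (hB ha) ?_ (.inl ha)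
      rcases mem_insert.mp hb with rfl | hb
      · exact hu
      rcases mem_insert.mp hb with rfl | hb
      · exact hv
      · exact hB hb
    rw [hS, sum_insert hu', sum_insert hvB, sum_insert hu', sum_insert hvB, sum_insert hu',
      sum_insert hvB, ← hS, edgeRow_diag, edgeRow_diag, smul_zero, smul_zero, zero_add, zero_add,
      Sym2.eq_swap (a := v) (b := u), mul_comm (c v) (c u)] at hsum
    -- The double sum runs over ordered pairs, so the pair `uv` occurs twice; characteristic zero
    -- allows division by 2.
    have h2 : (2 * (c u * c v)) • edgeRow p s(u, v) ∈ W := by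
      have : (2 * (c u * c v)) • edgeRow p s(u, v) =
          -(∑ b ∈ B, (c u * c b) • edgeRow p s(u, b) + (∑ b ∈ B, (c v * c b) • edgeRow p s(v, b) +
            ∑ a ∈ B, ∑ b ∈ S, (c a * c b) • edgeRow p s(a, b))) := by
        rw [eq_neg_iff_add_eq_zero, ← hsum, two_mul, add_smul]
        abel
      rw [this]
      exact W.neg_mem (W.add_mem (hBW u hu) (W.add_mem (hBW v hv) hBW'))
    refine (W.smul_mem_iff ?_).mp h2
    exact mul_ne_zero two_ne_zero (mul_ne_zero (hne u (by simp [hS])) (hne v (by simp [hS])))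

/-- The rank of a set of pairs of vertices in the rigidity matroid of the placement `p`. -/
noncomputable def rowRank (p : V → Fin d → K) (S : Set (Sym2 V)) : ℕ :=
  Module.finrank K (Submodule.span K (edgeRow p '' S))

theorem rowRank_eq_card {p : V → Fin d → K} {T : Finset (Sym2 V)}
    (h : LinearIndepOn K (edgeRow p) (T : Set (Sym2 V))) :
    rowRank p (T : Set (Sym2 V)) = T.card := by
  have := finrank_span_eq_card (R := K) h
  rw [Set.range_comp', Subtype.range_coe] at this
  simpa [rowRank] using this

variable [Fintype V]

theorem rowRank_mono (p : V → Fin d → K) {S T : Set (Sym2 V)} (h : S ⊆ T) :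
    rowRank p S ≤ rowRank p T :=
  Submodule.finrank_mono (Submodule.span_mono (Set.image_mono h))

theorem rowRank_le_card (p : V → Fin d → K) (T : Finset (Sym2 V)) :
    rowRank p (T : Set (Sym2 V)) ≤ T.card := by
  classical
  rw [rowRank, ← coe_image]
  exact (finrank_span_finset_le_card _).trans card_image_le

theorem rowRank_union_add_rowRank_inter_le (p : V → Fin d → K) (S T : Set (Sym2 V)) :
    rowRank p (S ∪ T) + rowRank p (S ∩ T) ≤ rowRank p S + rowRank p T := by
  have h := Submodule.finrank_sup_add_finrank_inf_eq (Submodule.span K (edgeRow p '' S))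
    (Submodule.span K (edgeRow p '' T))
  rw [← Submodule.span_union, ← Set.image_union] at h
  refine le_trans (Nat.add_le_add_left (Submodule.finrank_mono ?_) _) h.le
  exact le_inf (Submodule.span_mono (Set.image_mono Set.inter_subset_left))
    (Submodule.span_mono (Set.image_mono Set.inter_subset_right))

/-- The pairs in `X` that meet a fixed `d`-subset `B` form a basis of the complete graph on `X`. -/
theorem rowRank_sym2_add_choose [CharZero K] {p : V → Fin d → K} (hp : InGeneralPosition p)
    {X : Finset V} (hX : d ≤ X.card) :
    rowRank p (X.sym2 : Set (Sym2 V)) + (d + 1).choose 2 = d * X.card := by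
  obtain ⟨B, hB, hBd⟩ := exists_subset_card_eq hX
  rw [← joinEdges_card hB hBd, add_left_inj]
  apply le_antisymm
  · refine le_trans ?_ (rowRank_le_card p _)
    apply Submodule.finrank_mono
    rw [Submodule.span_le]
    rintro _ ⟨e, he, rfl⟩
    exact edgeRow_mem_span_joinEdges hp hB hBd he
  · rw [← rowRank_eq_card (p := p) (T := joinEdges B X)]
    · exact rowRank_mono p (coe_subset.mpr (filter_subset _ _))
    · exact linearIndepOn_edgeRow hp (fun e he => (mem_filter.mp he).2.1)
        (exists_degree_joinEdges_le hBd)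

end RowRank

/-! ### Tight sets, and edges shared between members of a family -/

section SparseFamilies

variable {V : Type*} [DecidableEq V] {d : ℕ} {F : Finset (Sym2 V)}

theorem card_filter_mem_inter_sym2_lt (hF : ∀ e ∈ F, ¬ e.IsDiag) {B : Finset V} {v : V}
    (hv : v ∈ B) : #{e ∈ F ∩ B.sym2 | v ∈ e} < #B := by
  rw [filter_mem_inter_sym2 _ _ _ hv]
  refine lt_of_le_of_lt card_image_le (lt_of_le_of_lt (card_le_card ?_) (card_erase_lt_of_mem hv))
  intro u hu
  obtain ⟨hu, hvu⟩ := mem_filter.mp hu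
  refine mem_erase.mpr ⟨?_, hu⟩
  rintro rfl
  exact hF _ hvu (by simp)

theorem inter_sym2_inter (A B : Finset V) : A.sym2 ∩ B.sym2 = (A ∩ B).sym2 := by
  ext e
  simp only [mem_inter, mem_sym2_iff]
  exact ⟨fun h a ha => ⟨h.1 a ha, h.2 a ha⟩,
    fun h => ⟨fun a ha => (h a ha).1, fun a ha => (h a ha).2⟩⟩

/-- The set `F` of edges is `d`-sparse. -/
def SparseEdges (d : ℕ) (F : Finset (Sym2 V)) : Prop :=
  ∀ X : Finset V, d ≤ #X → #(F ∩ X.sym2) + (d + 1).choose 2 ≤ d * #X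

/-- `X` induces as many edges of `F` as a `d`-sparse set of edges may contain. -/
def TightSet (d : ℕ) (F : Finset (Sym2 V)) (X : Finset V) : Prop :=
  d ≤ #X ∧ #(F ∩ X.sym2) + (d + 1).choose 2 = d * #X

/-- The number of induced edges is supermodular and the sparsity bound is modular; the hypothesis on
`X ∩ Z` makes that bound available for the intersection. -/
theorem TightSet.union (hF : SparseEdges d F) {X Z : Finset V} (hX : TightSet d F X)
    (hZ : TightSet d F Z) (h : d ≤ #(X ∩ Z)) : TightSet d F (X ∪ Z) := by
  have h1 : d ≤ #(X ∪ Z) := hX.1.trans (card_le_card subset_union_left)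
  refine ⟨h1, le_antisymm (hF _ h1) ?_⟩
  have h2 := hF _ h
  have h3 := card_union_add_card_inter (F ∩ X.sym2) (F ∩ Z.sym2)
  rw [← inter_inter_distrib_left, inter_sym2_inter] at h3
  have h4 : #(F ∩ X.sym2 ∪ F ∩ Z.sym2) ≤ #(F ∩ (X ∪ Z).sym2) :=
    card_le_card (union_subset (inter_subset_inter_left (sym2_mono subset_union_left))
      (inter_subset_inter_left (sym2_mono subset_union_right)))
  have h5 := card_union_add_card_inter X Z
  have h6 := hX.2
  have h7 := hZ.2
  have h8 : d * #(X ∪ Z) + d * #(X ∩ Z) = d * #X + d * #Z := by rw [← mul_add, ← mul_add, h5]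
  omega

/-- `X \ S` contains `Y`, so it is large enough for the sparsity bound; since `X` is tight, deleting
`S` must destroy at least `d * #S` edges. This is the Hall condition for the vertices outside `Y`.
-/
theorem TightSet.mul_card_le (hF : SparseEdges d F) {X Y S : Finset V} (hX : TightSet d F X)
    (hY : d ≤ #Y) (hYX : Y ⊆ X) (hS : S ⊆ X \ Y) :
    d * #S ≤ #{e ∈ F ∩ X.sym2 | ∃ v ∈ S, v ∈ e} := by
  have h1 := card_filter_add_card_filter_not (s := F ∩ X.sym2) (fun e => ∃ v ∈ S, v ∈ e)
  have h2 : {e ∈ F ∩ X.sym2 | ¬ ∃ v ∈ S, v ∈ e} = F ∩ (X \ S).sym2 := by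
    ext e
    simp only [mem_filter, mem_inter, mem_sym2_iff, mem_sdiff, not_exists, not_and, and_assoc]
    refine and_congr_right fun _ => ⟨fun h a ha => ⟨h.1 a ha, fun haS => h.2 a haS ha⟩,
      fun h => ⟨fun a ha => (h a ha).1, fun a haS ha => (h a ha).2 haS⟩⟩
  have hSX : S ⊆ X := hS.trans sdiff_subset
  have h3 : Y ⊆ X \ S := fun a ha =>
    mem_sdiff.mpr ⟨hYX ha, fun h => (mem_sdiff.mp (hS h)).2 ha⟩
  have h4 := hF (X \ S) (hY.trans (card_le_card h3))
  have h5 := hX.2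
  have h6 := card_sdiff_add_card_eq_card hSX
  have h7 : d * #(X \ S) + d * #S = d * #X := by rw [← mul_add, h6]
  rw [h2] at h1
  omega

/-- A weighted consequence of Hall's theorem: if every set of vertices in `R` meets many edges,
then the weights of the vertices are bounded by the weights of the edges. -/
theorem mul_sum_le_sum_of_hall {R : Finset V} {E : Finset (Sym2 V)} {a : V → ℚ} {w : Sym2 V → ℚ}
    (h : ∀ S ⊆ R, d * #S ≤ #{e ∈ E | ∃ v ∈ S, v ∈ e})
    (haw : ∀ v ∈ R, ∀ e ∈ E, v ∈ e → a v ≤ w e) (hw : ∀ e ∈ E, 0 ≤ w e) :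
    d * ∑ v ∈ R, a v ≤ ∑ e ∈ E with ∃ v ∈ R, v ∈ e, w e := by
  -- Each vertex is taken in `d` copies, so that a matching assigns to it `d` incident edges, all
  -- distinct over all vertices.
  let t : R × Fin d → Finset (Sym2 V) := fun x => {e ∈ E | (x.1 : V) ∈ e}
  have hall : ∀ S : Finset (R × Fin d), #S ≤ #(S.biUnion t) := by
    intro S
    let S' : Finset V := S.image fun x => (x.1 : V)
    have h1 : #S ≤ d * #S' := by
      have := card_le_mul_card_image (f := fun x : R × Fin d => (x.1 : V)) S d ?_
      · exact this
      · intro v _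
        calc #{x ∈ S | (x.1 : V) = v} ≤ #(univ : Finset (Fin d)) := by
              apply card_le_card_of_injOn (fun x => x.2) (by simp)
              intro x hx y hy hxy
              have hx' := (mem_filter.mp (mem_coe.mp hx)).2
              have hy' := (mem_filter.mp (mem_coe.mp hy)).2
              exact Prod.ext (Subtype.ext (hx'.trans hy'.symm)) hxy
          _ = d := by simp
    have h2 : S' ⊆ R := by
      intro v hv
      obtain ⟨x, _, rfl⟩ := mem_image.mp hv
      exact x.1.2
    refine h1.trans ((h S' h2).trans (card_le_card ?_))
    intro e he
    obtain ⟨heE, v, hv, hve⟩ := mem_filter.mp he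
    obtain ⟨x, hx, rfl⟩ := mem_image.mp hv
    exact mem_biUnion.mpr ⟨x, hx, mem_filter.mpr ⟨heE, hve⟩⟩
  obtain ⟨f, hf, hft⟩ := (Finset.all_card_le_biUnion_card_iff_exists_injective t).mp hall
  have hft' : ∀ x, f x ∈ E ∧ (x.1 : V) ∈ f x := fun x => mem_filter.mp (hft x)
  calc d * ∑ v ∈ R, a v = ∑ x : R × Fin d, a x.1 := by
        rw [Fintype.sum_prod_type]
        simp only [sum_const, card_univ, Fintype.card_fin, nsmul_eq_mul, ← mul_sum]
        rw [sum_coe_sort R a]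
    _ ≤ ∑ x : R × Fin d, w (f x) :=
        sum_le_sum fun x _ => haw x.1 x.1.2 _ (hft' x).1 (hft' x).2
    _ = ∑ e ∈ univ.image f, w e := (sum_image fun x _ y _ hxy => hf hxy).symm
    _ ≤ _ := by
        refine sum_le_sum_of_subset_of_nonneg ?_ fun e he _ => hw e (mem_filter.mp he).1
        intro e he
        obtain ⟨x, _, rfl⟩ := mem_image.mp he
        exact mem_filter.mpr ⟨(hft' x).1, x.1, x.1.2, (hft' x).2⟩

/-- The edges of `F` which are induced by `X` and by another member of `𝒜`. -/
def sharedEdges (𝒜 : Finset (Finset V)) (F : Finset (Sym2 V)) (X : Finset V) : Finset (Sym2 V) :=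
  {e ∈ F ∩ X.sym2 | ∃ Z ∈ 𝒜, Z ≠ X ∧ e ∈ Z.sym2}

/-- The number of members of `𝒜` which contain the vertex `v`. -/
def vertexMult (𝒜 : Finset (Finset V)) (v : V) : ℕ := #{Z ∈ 𝒜 | v ∈ Z}

/-- The number of members of `𝒜` which induce the edge `e`. -/
def edgeMult (𝒜 : Finset (Finset V)) (e : Sym2 V) : ℕ := #{Z ∈ 𝒜 | e ∈ Z.sym2}

theorem edgeMult_le_vertexMult (𝒜 : Finset (Finset V)) {e : Sym2 V} {v : V} (hv : v ∈ e) :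
    edgeMult 𝒜 e ≤ vertexMult 𝒜 v :=
  card_le_card (monotone_filter_right _ fun _ _ h => mem_sym2_iff.mp h v hv)

theorem edgeMult_pos {𝒜 : Finset (Finset V)} {X : Finset V} (hX : X ∈ 𝒜) {e : Sym2 V}
    (he : e ∈ X.sym2) : 0 < edgeMult 𝒜 e :=
  card_pos.mpr ⟨X, mem_filter.mpr ⟨hX, he⟩⟩

theorem two_le_edgeMult {𝒜 : Finset (Finset V)} {X : Finset V} (hX : X ∈ 𝒜) {e : Sym2 V}
    (he : e ∈ sharedEdges 𝒜 F X) : 2 ≤ edgeMult 𝒜 e := by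
  obtain ⟨he, Z, hZ, hZX, heZ⟩ := mem_filter.mp he
  exact one_lt_card.mpr ⟨Z, mem_filter.mpr ⟨hZ, heZ⟩, X,
    mem_filter.mpr ⟨hX, (mem_inter.mp he).2⟩, hZX⟩

variable {𝒜 : Finset (Finset V)}

/-- Count pairs of an edge of `N` and a member inducing it. `X` itself contributes `#N`. Any other
`Z` through `v` meets `X` in at most `d - 1` vertices including `v`, hence contributes at most `d -
2` edges at `v`. -/
theorem sum_edgeMult_le (hF : ∀ e ∈ F, ¬ e.IsDiag)
    (hpair : ∀ X ∈ 𝒜, ∀ Z ∈ 𝒜, X ≠ Z → #(X ∩ Z) < d) {X : Finset V} (hX : X ∈ 𝒜) {v : V}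
    (hv : v ∈ X) {N : Finset (Sym2 V)} (hN : N ⊆ F ∩ X.sym2) (hvN : ∀ e ∈ N, v ∈ e) :
    ∑ e ∈ N, edgeMult 𝒜 e ≤ #N + (vertexMult 𝒜 v - 1) * (d - 2) := by
  have h1 : ∀ e ∈ N, edgeMult 𝒜 e = ∑ Z ∈ 𝒜 with v ∈ Z, if e ∈ Z.sym2 then 1 else 0 := by
    intro e he
    rw [edgeMult, ← card_filter, filter_filter]
    congr 1
    refine filter_congr fun Z _ => ⟨fun h => ⟨mem_sym2_iff.mp h v (hvN e he), h⟩, fun h => h.2⟩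
  rw [sum_congr rfl h1, sum_comm]
  have hXv : X ∈ {Z ∈ 𝒜 | v ∈ Z} := mem_filter.mpr ⟨hX, hv⟩
  rw [← add_sum_erase _ _ hXv]
  refine Nat.add_le_add ?_ ?_
  · rw [← card_filter]
    exact card_filter_le _ _
  · rw [vertexMult, ← card_erase_of_mem hXv, ← smul_eq_mul]
    refine sum_le_card_nsmul _ _ _ fun Z hZ => ?_
    obtain ⟨hZX, hZ⟩ := mem_erase.mp hZ
    obtain ⟨hZ, hvZ⟩ := mem_filter.mp hZ
    rw [← card_filter]
    have h2 : {e ∈ N | e ∈ Z.sym2} ⊆ {e ∈ F ∩ (X ∩ Z).sym2 | v ∈ e} := by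
      intro e he
      obtain ⟨he, heZ⟩ := mem_filter.mp he
      refine mem_filter.mpr ⟨?_, hvN e he⟩
      rw [← inter_sym2_inter, ← inter_assoc]
      exact mem_inter.mpr ⟨hN he, heZ⟩
    have h3 := card_filter_mem_inter_sym2_lt hF (mem_inter.mpr ⟨hv, hvZ⟩)
    have h4 := hpair X hX Z hZ hZX.symm
    have h5 := card_le_card h2
    omega

/-- The left side is the secant of `1 / m` through `t` and `t + 1`. It lies below at every positive
integer because `(m - t) * (m - t - 1) ≥ 0` there. -/
theorem inv_ge_tangent (t m : ℕ) (ht : 0 < t) (hm : 0 < m) :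
    (2 * t + 1 - m : ℚ) / (t * (t + 1)) ≤ 1 / m := by
  have h : (0 : ℚ) ≤ ((m : ℚ) - t) * (m - t - 1) := by
    rcases Nat.lt_or_ge t m with h | h
    · have h1 : (t : ℚ) + 1 ≤ m := by exact_mod_cast h
      apply mul_nonneg <;> linarith
    · have h1 : (m : ℚ) ≤ t := by exact_mod_cast h
      apply mul_nonneg_of_nonpos_of_nonpos <;> linarith
  have ht' : (0 : ℚ) < t := by exact_mod_cast ht
  have hm' : (0 : ℚ) < m := by exact_mod_cast hm
  rw [div_le_div_iff₀ (by positivity) hm']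
  nlinarith

/-- For `d ≤ 5` and `#N ≥ d + 1` the mean multiplicity is at most `(k + 1) / 2`, so the secant at `t
= ⌊k / 2⌋` is the right linear bound. Jensen for `1 / m` over the reals would not suffice: for `d =
5`, `k = 4` the integral bound is attained with equality. -/
theorem le_sum_inv_edgeMult (hd5 : d ≤ 5) (hd3 : 3 ≤ d) {k : ℕ} (hk : 4 ≤ k)
    {N : Finset (Sym2 V)} (hN : d < #N) (hpos : ∀ e ∈ N, 0 < edgeMult 𝒜 e)
    (hsum : ∑ e ∈ N, edgeMult 𝒜 e ≤ #N + (k - 1) * (d - 2)) :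
    (2 * d : ℚ) / k ≤ ∑ e ∈ N, 1 / (edgeMult 𝒜 e : ℚ) := by
  obtain ⟨t, ht⟩ : ∃ t, k = 2 * t ∨ k = 2 * t + 1 := ⟨k / 2, by omega⟩
  have ht2 : 2 ≤ t := by omega
  have h1 : ∑ e ∈ N, (2 * t + 1 - edgeMult 𝒜 e : ℚ) / (t * (t + 1)) ≤
      ∑ e ∈ N, 1 / (edgeMult 𝒜 e : ℚ) :=
    sum_le_sum fun e he => inv_ge_tangent t _ (by omega) (hpos e he)
  refine le_trans ?_ h1
  rw [← sum_div, sum_sub_distrib, sum_const, nsmul_eq_mul]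
  have h2 : (∑ e ∈ N, (edgeMult 𝒜 e : ℚ)) ≤ #N + ((k : ℚ) - 1) * (d - 2) := by
    have : ((∑ e ∈ N, edgeMult 𝒜 e : ℕ) : ℚ) ≤ ((#N + (k - 1) * (d - 2) : ℕ) : ℚ) := by
      exact_mod_cast hsum
    rw [Nat.cast_sum] at this
    refine this.trans (le_of_eq ?_)
    push_cast [Nat.cast_sub (show 1 ≤ k by omega), Nat.cast_sub (show 2 ≤ d by omega)]
    ring
  have h3 : (d : ℚ) + 1 ≤ #N := by exact_mod_cast hN
  have ht' : (2 : ℚ) ≤ t := by exact_mod_cast ht2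
  have hk' : (0 : ℚ) < k := by exact_mod_cast (show 0 < k by omega)
  rw [div_le_div_iff₀ hk' (by positivity)]
  have h4 : (2 * t * (d + 1) - (k - 1) * (d - 2) : ℚ) ≤
      #N * (2 * t + 1) - ∑ e ∈ N, (edgeMult 𝒜 e : ℚ) := by
    have : (2 * t : ℚ) * (d + 1) ≤ 2 * t * #N := by gcongr
    linarith
  refine le_trans ?_ (mul_le_mul_of_nonneg_right h4 hk'.le)
  have h5 : (k : ℚ) = 2 * t ∨ (k : ℚ) = 2 * t + 1 := by
    rcases ht with h | h
    · left; exact_mod_cast h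
    · right; exact_mod_cast h
  interval_cases d <;> rcases h5 with h | h <;> rw [h] <;> push_cast <;> nlinarith

/-- A family of tight sets with small intersections, each of which has a nonempty set `Y X` of
vertices such that the edges shared with other members of the family have large degrees in
`Y X`. -/
structure HighDegreeFamily (d : ℕ) (F : Finset (Sym2 V)) (𝒜 : Finset (Finset V))
    (Y : Finset V → Finset V) : Prop where
  not_isDiag : ∀ e ∈ F, ¬ e.IsDiag
  sparse : SparseEdges d F
  tight : ∀ X ∈ 𝒜, TightSet d F X
  inter_card : ∀ X ∈ 𝒜, ∀ Z ∈ 𝒜, X ≠ Z → #(X ∩ Z) < d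
  nonempty : ∀ X ∈ 𝒜, (Y X).Nonempty
  degree : ∀ X ∈ 𝒜, ∀ v ∈ Y X, d < #{e ∈ sharedEdges 𝒜 F X ∩ (Y X).sym2 | v ∈ e}

end SparseFamilies

/-! ### The discharging argument -/

namespace HighDegreeFamily

variable {V : Type*} [DecidableEq V] {d : ℕ} {F : Finset (Sym2 V)} {𝒜 : Finset (Finset V)}
  {Y : Finset V → Finset V}

theorem star_subset {X : Finset V} {v : V} :
    {e ∈ sharedEdges 𝒜 F X ∩ (Y X).sym2 | v ∈ e} ⊆ F ∩ X.sym2 :=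
  (filter_subset _ _).trans (inter_subset_left.trans (filter_subset _ _))

theorem subset (h : HighDegreeFamily d F 𝒜 Y) {X : Finset V} (hX : X ∈ 𝒜) : Y X ⊆ X := by
  intro v hv
  obtain ⟨e, he⟩ := card_pos.mp ((Nat.zero_le d).trans_lt (h.degree X hX v hv))
  exact mem_sym2_iff.mp (mem_inter.mp (star_subset he)).2 v (mem_filter.mp he).2

theorem le_card (h : HighDegreeFamily d F 𝒜 Y) {X : Finset V} (hX : X ∈ 𝒜) : d ≤ #(Y X) := by
  obtain ⟨v, hv⟩ := h.nonempty X hX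
  have h1 := h.degree X hX v hv
  have h2 := card_filter_mem_inter_sym2_lt (F := sharedEdges 𝒜 F X)
    (fun e he => h.not_isDiag e (mem_inter.mp (mem_filter.mp he).1).1) hv
  omega

theorem sum_star_le (h : HighDegreeFamily d F 𝒜 Y) {X : Finset V} (hX : X ∈ 𝒜) {v : V}
    (hv : v ∈ Y X) :
    ∑ e ∈ sharedEdges 𝒜 F X ∩ (Y X).sym2 with v ∈ e, edgeMult 𝒜 e ≤
      #{e ∈ sharedEdges 𝒜 F X ∩ (Y X).sym2 | v ∈ e} + (vertexMult 𝒜 v - 1) * (d - 2) :=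
  sum_edgeMult_le h.not_isDiag h.inter_card hX (h.subset hX hv) star_subset
    fun _ he => (mem_filter.mp he).2

/-- Shared edges have multiplicity at least 2, so the upper bound on the sum of multiplicities
bounds the degree, which exceeds `d`. Small values of `d` and of the vertex multiplicity are thereby
excluded. -/
theorem succ_le_mul (h : HighDegreeFamily d F 𝒜 Y) {X : Finset V} (hX : X ∈ 𝒜) {v : V}
    (hv : v ∈ Y X) : d + 1 ≤ (vertexMult 𝒜 v - 1) * (d - 2) := by
  have h1 := h.sum_star_le hX hv
  have h2 := h.degree X hX v hv
  have h3 := card_nsmul_le_sum {e ∈ sharedEdges 𝒜 F X ∩ (Y X).sym2 | v ∈ e}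
    (fun e => edgeMult 𝒜 e) 2
    fun e he => two_le_edgeMult hX (mem_inter.mp (mem_filter.mp he).1).1
  rw [smul_eq_mul] at h3
  omega

theorem three_le_dim (h : HighDegreeFamily d F 𝒜 Y) {X : Finset V} (hX : X ∈ 𝒜) {v : V}
    (hv : v ∈ Y X) : 3 ≤ d := by
  by_contra hd
  have h1 := h.succ_le_mul hX hv
  have : d - 2 = 0 := by omega
  rw [this] at h1
  omega

theorem three_le_vertexMult (h : HighDegreeFamily d F 𝒜 Y) {X : Finset V} (hX : X ∈ 𝒜) {v : V}
    (hv : v ∈ Y X) : 3 ≤ vertexMult 𝒜 v := by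
  by_contra hk
  have h1 := h.succ_le_mul hX hv
  have : (vertexMult 𝒜 v - 1) * (d - 2) ≤ 1 * (d - 2) := Nat.mul_le_mul_right _ (by omega)
  omega

theorem dim_eq_five (h : HighDegreeFamily d F 𝒜 Y) (hd : d ≤ 5) {X : Finset V} (hX : X ∈ 𝒜)
    {v : V} (hv : v ∈ Y X) (hk : vertexMult 𝒜 v = 3) : d = 5 := by
  have h1 := h.succ_le_mul hX hv
  rw [hk] at h1
  omega

theorem filter_mem_eq {v : V} (hk : vertexMult 𝒜 v = 3) {X Z W : Finset V} (hX : X ∈ 𝒜)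
    (hZ : Z ∈ 𝒜) (hW : W ∈ 𝒜) (hvX : v ∈ X) (hvZ : v ∈ Z) (hvW : v ∈ W) (hXZ : X ≠ Z)
    (hXW : X ≠ W) (hZW : Z ≠ W) : {T ∈ 𝒜 | v ∈ T} = {X, Z, W} := by
  symm
  apply eq_of_subset_of_card_le
  · intro T hT
    simp only [mem_insert, mem_singleton] at hT
    rcases hT with rfl | rfl | rfl <;> simp [*]
  · rw [card_eq_three.mpr ⟨X, Z, W, hXZ, hXW, hZW, rfl⟩]
    exact hk.le

theorem exists_others {v : V} (hk : vertexMult 𝒜 v = 3) {X : Finset V} (hX : X ∈ 𝒜)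
    (hvX : v ∈ X) : ∃ Z W, Z ∈ 𝒜 ∧ W ∈ 𝒜 ∧ v ∈ Z ∧ v ∈ W ∧ X ≠ Z ∧ X ≠ W ∧ Z ≠ W := by
  have hX' : X ∈ {T ∈ 𝒜 | v ∈ T} := mem_filter.mpr ⟨hX, hvX⟩
  have h1 : #({T ∈ 𝒜 | v ∈ T}.erase X) = 2 := by
    rw [card_erase_of_mem hX', ← vertexMult, hk]
  obtain ⟨Z, W, hZW, h2⟩ := card_eq_two.mp h1
  have hZ : Z ∈ {T ∈ 𝒜 | v ∈ T}.erase X := by simp [h2]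
  have hW : W ∈ {T ∈ 𝒜 | v ∈ T}.erase X := by simp [h2]
  simp only [mem_erase, mem_filter] at hZ hW
  exact ⟨Z, W, hZ.2.1, hW.2.1, hZ.2.2, hW.2.2, hZ.1.symm, hW.1.symm, hZW⟩

/-- Here `d = 5`, and the at least six shared edges at `v` end in `X ∩ Z` or `X ∩ W`, each with at
most three vertices besides `v`. So both bounds are attained and the two sets share only `v`. -/
theorem inter_of_vertexMult_eq_three (h : HighDegreeFamily d F 𝒜 Y) (hd : d ≤ 5)
    {v : V} (hk : vertexMult 𝒜 v = 3) {X Z W : Finset V} (hX : X ∈ 𝒜) (hvX : v ∈ Y X)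
    (hZ : Z ∈ 𝒜) (hW : W ∈ 𝒜) (hvZ : v ∈ Z) (hvW : v ∈ W) (hXZ : X ≠ Z)
    (hXW : X ≠ W) (hZW : Z ≠ W) : #(X ∩ Z) = 4 ∧ #(X ∩ W) = 4 ∧ X ∩ Z ∩ W = {v} := by
  have hd5 := h.dim_eq_five hd hX hvX hk
  have hvX' := h.subset hX hvX
  have hfil := filter_mem_eq hk hX hZ hW hvX' hvZ hvW hXZ hXW hZW
  have h1 := h.inter_card X hX Z hZ hXZ
  have h2 := h.inter_card X hX W hW hXW
  have h3 := h.degree X hX v hvX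
  have hA : #((X ∩ Z).erase v) + 1 = #(X ∩ Z) := card_erase_add_one (by simp [*])
  have hB : #((X ∩ W).erase v) + 1 = #(X ∩ W) := card_erase_add_one (by simp [*])
  have h4 := card_union_add_card_inter ((X ∩ Z).erase v) ((X ∩ W).erase v)
  have h5 : {e ∈ sharedEdges 𝒜 F X ∩ (Y X).sym2 | v ∈ e} ⊆
      ((X ∩ Z).erase v ∪ (X ∩ W).erase v).image (fun u => s(v, u)) := by
    intro e he
    obtain ⟨he', hve⟩ := mem_filter.mp he
    obtain ⟨heX, T, hT, hTX, heT⟩ := mem_filter.mp (mem_inter.mp he').1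
    obtain ⟨heF, heX⟩ := mem_inter.mp heX
    obtain ⟨u, rfl⟩ := hve
    have huv : u ≠ v := by
      rintro rfl
      exact h.not_isDiag _ heF (by simp)
    obtain ⟨hvT, huT⟩ := mk_mem_sym2_iff.mp heT
    have huX := (mk_mem_sym2_iff.mp heX).2
    have hT' : T ∈ {T ∈ 𝒜 | v ∈ T} := mem_filter.mpr ⟨hT, hvT⟩
    rw [hfil, mem_insert, mem_insert, mem_singleton] at hT'
    refine mem_image.mpr ⟨u, ?_, rfl⟩
    rcases hT' with rfl | rfl | rfl
    · exact absurd rfl hTX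
    · simp [huv, huX, huT]
    · simp [huv, huX, huT]
  have h6 := (card_le_card h5).trans card_image_le
  refine ⟨by omega, by omega, ?_⟩
  have h7 : (X ∩ Z).erase v ∩ (X ∩ W).erase v = ∅ := card_eq_zero.mp (by omega)
  ext u
  simp only [mem_inter, mem_singleton]
  constructor
  · rintro ⟨⟨hu1, hu2⟩, hu3⟩
    by_contra huv
    have : u ∈ (X ∩ Z).erase v ∩ (X ∩ W).erase v :=
      mem_inter.mpr ⟨mem_erase.mpr ⟨huv, mem_inter.mpr ⟨hu1, hu2⟩⟩,
        mem_erase.mpr ⟨huv, mem_inter.mpr ⟨hu1, hu3⟩⟩⟩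
    rw [h7] at this
    exact notMem_empty _ this
  · rintro rfl
    exact ⟨⟨hvX', hvZ⟩, hvW⟩

/-- Otherwise all three members through `v` meet pairwise in four vertices and jointly only in `v`.
Their union has 11 vertices fewer than the sum of their sizes and loses at most 18 edges by
overlaps, exceeding the sparsity bound by 7. -/
theorem eq_of_mem_of_vertexMult_eq_three (h : HighDegreeFamily d F 𝒜 Y) (hd : d ≤ 5)
    {v : V} (hk : vertexMult 𝒜 v = 3) {X Z : Finset V} (hX : X ∈ 𝒜) (hZ : Z ∈ 𝒜)
    (hvX : v ∈ Y X) (hvZ : v ∈ Y Z) : X = Z := by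
  by_contra hXZ
  have hvX' := h.subset hX hvX
  have hvZ' := h.subset hZ hvZ
  have hd5 := h.dim_eq_five hd hX hvX hk
  obtain ⟨W, hW, hvW, hXW, hZW⟩ : ∃ W ∈ 𝒜, v ∈ W ∧ X ≠ W ∧ Z ≠ W := by
    obtain ⟨A, B, hA, hB, hvA, hvB, hXA, hXB, hAB⟩ := exists_others hk hX hvX'
    by_cases hZA : Z = A
    · exact ⟨B, hB, hvB, hXB, hZA ▸ hAB⟩
    · exact ⟨A, hA, hvA, hXA, hZA⟩
  obtain ⟨h1, h2, h3⟩ := h.inter_of_vertexMult_eq_three hd hk hX hvX hZ hW hvZ' hvW hXZ hXW hZW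
  obtain ⟨-, h4, -⟩ := h.inter_of_vertexMult_eq_three hd hk hZ hvZ hX hW hvX' hvW
    (Ne.symm hXZ) hZW hXW
  have hpair : ∀ B : Finset V, #B = 4 → #(F ∩ B.sym2) ≤ 6 := by
    intro B hB
    have h5 : F ∩ B.sym2 ⊆ {e ∈ B.sym2 | ¬ e.IsDiag} := fun e he =>
      mem_filter.mpr ⟨(mem_inter.mp he).2, h.not_isDiag e (mem_inter.mp he).1⟩
    refine (card_le_card h5).trans ?_
    rw [sym2_filter_not_isDiag_card, hB]
    decide
  have e1 := card_union_add_card_inter X Z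
  have e2 := card_union_add_card_inter (X ∪ Z) W
  have e3 := card_union_add_card_inter (X ∩ W) (Z ∩ W)
  rw [← union_inter_distrib_right, ← inter_inter_distrib_right, h3, card_singleton] at e3
  have f1 := card_union_add_card_inter (F ∩ X.sym2) (F ∩ Z.sym2)
  have f2 := card_union_add_card_inter (F ∩ X.sym2 ∪ F ∩ Z.sym2) (F ∩ W.sym2)
  rw [← inter_inter_distrib_left, inter_sym2_inter] at f1
  have f3 : #((F ∩ X.sym2 ∪ F ∩ Z.sym2) ∩ (F ∩ W.sym2)) ≤
      #(F ∩ (X ∩ W).sym2) + #(F ∩ (Z ∩ W).sym2) := by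
    rw [union_inter_distrib_right, ← inter_inter_distrib_left, ← inter_inter_distrib_left,
      inter_sym2_inter, inter_sym2_inter]
    exact card_union_le _ _
  have g1 := hpair _ h1
  have g2 := hpair _ h2
  have g3 := hpair _ h4
  have f4 : F ∩ X.sym2 ∪ F ∩ Z.sym2 ∪ F ∩ W.sym2 ⊆ F ∩ (X ∪ Z ∪ W).sym2 := by
    rw [← inter_union_distrib_left, ← inter_union_distrib_left]
    refine inter_subset_inter_left (union_subset (union_subset ?_ ?_) ?_) <;>
      apply sym2_mono
    · exact subset_union_left.trans subset_union_left
    · exact subset_union_right.trans subset_union_left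
    · exact subset_union_right
  have f5 := card_le_card f4
  have tX := h.tight X hX
  have tZ := h.tight Z hZ
  have tW := h.tight W hW
  have f6 := h.sparse (X ∪ Z ∪ W)
    (tW.1.trans (card_le_card subset_union_right))
  have tX2 := tX.2
  have tZ2 := tZ.2
  have tW2 := tW.2
  subst hd5
  have h7 : (5 + 1).choose 2 = 15 := by decide
  rw [h7] at f6 tX2 tZ2 tW2
  omega

/-- An edge at `v` in all three members would have its other end in their common intersection `{v}`.
-/
theorem edgeMult_le_two (h : HighDegreeFamily d F 𝒜 Y) (hd : d ≤ 5)
    {v : V} (hk : vertexMult 𝒜 v = 3) {X : Finset V} (hX : X ∈ 𝒜) (hvX : v ∈ Y X)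
    {e : Sym2 V} (he : e ∈ F) (hve : v ∈ e) : edgeMult 𝒜 e ≤ 2 := by
  by_contra hlt
  have hvX' := h.subset hX hvX
  obtain ⟨Z, W, hZ, hW, hvZ, hvW, hXZ, hXW, hZW⟩ := exists_others hk hX hvX'
  obtain ⟨-, -, h3⟩ := h.inter_of_vertexMult_eq_three hd hk hX hvX hZ hW hvZ hvW hXZ hXW hZW
  have h1 : {T ∈ 𝒜 | e ∈ T.sym2} = {T ∈ 𝒜 | v ∈ T} := by
    apply eq_of_subset_of_card_le (monotone_filter_right _ fun _ _ h => mem_sym2_iff.mp h v hve)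
    rw [← vertexMult, ← edgeMult, hk]
    omega
  have hmem : ∀ T ∈ 𝒜, v ∈ T → e ∈ T.sym2 := by
    intro T hT hvT
    have : T ∈ {T ∈ 𝒜 | v ∈ T} := mem_filter.mpr ⟨hT, hvT⟩
    rw [← h1] at this
    exact (mem_filter.mp this).2
  obtain ⟨u, rfl⟩ := hve
  have hu : u ∈ X ∩ Z ∩ W := by
    have h4 := (mk_mem_sym2_iff.mp (hmem X hX hvX')).2
    have h5 := (mk_mem_sym2_iff.mp (hmem Z hZ hvZ)).2
    have h6 := (mk_mem_sym2_iff.mp (hmem W hW hvW)).2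
    exact mem_inter.mpr ⟨mem_inter.mpr ⟨h4, h5⟩, h6⟩
  rw [h3, mem_singleton] at hu
  subst hu
  exact h.not_isDiag _ he (by simp)

open Classical in
/-- The share of the vertex `v` which is charged to the member `X` of the family. -/
noncomputable def share (𝒜 : Finset (Finset V)) (Y : Finset V → Finset V) (X : Finset V)
    (v : V) : ℚ :=
  if vertexMult 𝒜 v = 3 ∧ ∃ Z ∈ 𝒜, v ∈ Y Z then (if v ∈ Y X then 0 else 1 / 2)
  else 1 / vertexMult 𝒜 v

/-- In the exceptional case exactly one of the three members has `v` in its high-degree set, so the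
shares are 0, 1/2 and 1/2. The equal split 1/3 would fail inside that set when `d = 5`, as the
secant estimate needs multiplicity at least 4. -/
theorem sum_share (h : HighDegreeFamily d F 𝒜 Y) (hd : d ≤ 5) {v : V}
    (hv : 0 < vertexMult 𝒜 v) : ∑ X ∈ 𝒜 with v ∈ X, share 𝒜 Y X v = 1 := by
  by_cases hs : vertexMult 𝒜 v = 3 ∧ ∃ Z ∈ 𝒜, v ∈ Y Z
  · obtain ⟨hk, X, hX, hvX⟩ := id hs
    have hvX' := h.subset hX hvX
    obtain ⟨Z, W, hZ, hW, hvZ, hvW, hXZ, hXW, hZW⟩ := exists_others hk hX hvX'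
    have hZ' : v ∉ Y Z := fun hh => hXZ (h.eq_of_mem_of_vertexMult_eq_three hd hk hX hZ hvX hh)
    have hW' : v ∉ Y W := fun hh => hXW (h.eq_of_mem_of_vertexMult_eq_three hd hk hX hW hvX hh)
    rw [filter_mem_eq hk hX hZ hW hvX' hvZ hvW hXZ hXW hZW, sum_insert (by simp [*]),
      sum_insert (by simp [*]), sum_singleton]
    simp only [share, if_pos hs, if_pos hvX, if_neg hZ', if_neg hW']
    norm_num
  · simp only [share, if_neg hs, sum_const, nsmul_eq_mul]
    rw [← vertexMult, mul_one_div_cancel]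
    exact_mod_cast hv.ne'

theorem share_le (h : HighDegreeFamily d F 𝒜 Y) (hd : d ≤ 5) {X : Finset V} (hX : X ∈ 𝒜)
    {v : V} (hvY : v ∉ Y X) {e : Sym2 V} (he : e ∈ F ∩ X.sym2) (hve : v ∈ e) :
    share 𝒜 Y X v ≤ 1 / edgeMult 𝒜 e := by
  have hpos : (0 : ℚ) < edgeMult 𝒜 e := by exact_mod_cast edgeMult_pos hX (mem_inter.mp he).2
  by_cases hs : vertexMult 𝒜 v = 3 ∧ ∃ Z ∈ 𝒜, v ∈ Y Z
  · rw [share, if_pos hs, if_neg hvY]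
    obtain ⟨hk, Z, hZ, hvZ⟩ := hs
    have h1 := h.edgeMult_le_two hd hk hZ hvZ (mem_inter.mp he).1 hve
    exact one_div_le_one_div_of_le hpos (by exact_mod_cast h1)
  · rw [share, if_neg hs]
    exact one_div_le_one_div_of_le hpos (by exact_mod_cast edgeMult_le_vertexMult 𝒜 hve)

theorem mul_share_le_sum_star (h : HighDegreeFamily d F 𝒜 Y) (hd : d ≤ 5) {X : Finset V}
    (hX : X ∈ 𝒜) {v : V} (hv : v ∈ Y X) :
    2 * d * share 𝒜 Y X v ≤
      ∑ e ∈ sharedEdges 𝒜 F X ∩ (Y X).sym2 with v ∈ e, 1 / (edgeMult 𝒜 e : ℚ) := by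
  by_cases hs : vertexMult 𝒜 v = 3 ∧ ∃ Z ∈ 𝒜, v ∈ Y Z
  · rw [share, if_pos hs, if_pos hv, mul_zero]
    exact sum_nonneg fun e _ => by positivity
  · have hk : 4 ≤ vertexMult 𝒜 v := by
      have h1 := h.three_le_vertexMult hX hv
      have h2 : vertexMult 𝒜 v ≠ 3 := fun h2 => hs ⟨h2, X, hX, hv⟩
      omega
    rw [share, if_neg hs, mul_one_div]
    exact le_sum_inv_edgeMult hd (h.three_le_dim hX hv) hk (h.degree X hX v hv)
      (fun e he => edgeMult_pos hX (mem_inter.mp (star_subset he)).2) (h.sum_star_le hX hv)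

/-- The edges of `F` in `X` split into those meeting `X \ Y X`, which pay for the vertices outside
`Y X` by Hall, and those inside `Y X`, which pay for `Y X`. Summing stars counts each of the latter
twice, matching the factor 2 in `mul_share_le_sum_star`. -/
theorem mul_sum_share_le (h : HighDegreeFamily d F 𝒜 Y) (hd : d ≤ 5) {X : Finset V}
    (hX : X ∈ 𝒜) :
    d * ∑ v ∈ X, share 𝒜 Y X v ≤ ∑ e ∈ F ∩ X.sym2, 1 / (edgeMult 𝒜 e : ℚ) := by
  have hYX := h.subset hX
  have hout := mul_sum_le_sum_of_hall (R := X \ Y X) (E := F ∩ X.sym2) (a := share 𝒜 Y X)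
    (w := fun e => 1 / (edgeMult 𝒜 e : ℚ))
    (fun S hS => (h.tight X hX).mul_card_le h.sparse (h.le_card hX) hYX hS)
    (fun v hv e he hve => h.share_le hd hX (mem_sdiff.mp hv).2 he hve)
    (fun e _ => by positivity)
  have hin : d * ∑ v ∈ Y X, share 𝒜 Y X v ≤
      ∑ e ∈ sharedEdges 𝒜 F X ∩ (Y X).sym2, 1 / (edgeMult 𝒜 e : ℚ) := by
    have h1 : ∑ v ∈ Y X, 2 * d * share 𝒜 Y X v ≤ ∑ v ∈ Y X,
        ∑ e ∈ sharedEdges 𝒜 F X ∩ (Y X).sym2 with v ∈ e, 1 / (edgeMult 𝒜 e : ℚ) :=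
      sum_le_sum fun v hv => h.mul_share_le_sum_star hd hX hv
    have h2 : ∑ v ∈ Y X, ∑ e ∈ sharedEdges 𝒜 F X ∩ (Y X).sym2 with v ∈ e,
          1 / (edgeMult 𝒜 e : ℚ) =
        2 * ∑ e ∈ sharedEdges 𝒜 F X ∩ (Y X).sym2, 1 / (edgeMult 𝒜 e : ℚ) := by
      rw [sum_comm' (t' := sharedEdges 𝒜 F X ∩ (Y X).sym2) (s' := fun e => e.toFinset)]
      · rw [mul_sum]
        refine sum_congr rfl fun e he => ?_
        have hediag : ¬ e.IsDiag :=
          h.not_isDiag e (mem_inter.mp (mem_filter.mp (mem_inter.mp he).1).1).1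
        rw [sum_const, Sym2.card_toFinset_of_not_isDiag e hediag, nsmul_eq_mul]
        norm_num
      · intro v e
        simp only [mem_filter, Sym2.mem_toFinset]
        constructor
        · rintro ⟨-, he, hve⟩
          exact ⟨hve, he⟩
        · rintro ⟨hve, he⟩
          exact ⟨mem_sym2_iff.mp (mem_inter.mp he).2 v hve, he, hve⟩
    rw [h2, ← mul_sum] at h1
    linarith
  rw [← sum_sdiff hYX, mul_add,
    ← sum_filter_add_sum_filter_not (F ∩ X.sym2) (fun e => ∃ v ∈ X \ Y X, v ∈ e)]
  refine add_le_add hout (hin.trans ?_)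
  refine sum_le_sum_of_subset_of_nonneg ?_ fun e _ _ => by positivity
  intro e he
  obtain ⟨he1, he2⟩ := mem_inter.mp he
  refine mem_filter.mpr ⟨(mem_filter.mp he1).1, ?_⟩
  rintro ⟨v, hv, hve⟩
  exact (mem_sdiff.mp hv).2 (mem_sym2_iff.mp he2 v hve)

theorem eq_empty (h : HighDegreeFamily d F 𝒜 Y) (hd1 : 1 ≤ d) (hd : d ≤ 5) : 𝒜 = ∅ := by
  by_contra hne
  obtain ⟨X₀, hX₀⟩ := nonempty_iff_ne_empty.mpr hne
  set U := 𝒜.biUnion id with hU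
  have hsub : ∀ X ∈ 𝒜, X ⊆ U := fun X hX => subset_biUnion_of_mem id hX
  have h1 : (d : ℚ) * ∑ X ∈ 𝒜, ∑ v ∈ X, share 𝒜 Y X v ≤
      ∑ X ∈ 𝒜, ∑ e ∈ F ∩ X.sym2, 1 / (edgeMult 𝒜 e : ℚ) := by
    rw [mul_sum]
    exact sum_le_sum fun X hX => h.mul_sum_share_le hd hX
  have h2 : ∑ X ∈ 𝒜, ∑ v ∈ X, share 𝒜 Y X v = #U := by
    rw [sum_comm' (t' := U) (s' := fun v => {X ∈ 𝒜 | v ∈ X})]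
    · rw [sum_congr rfl (g := fun _ => (1 : ℚ)), sum_const, nsmul_eq_mul, mul_one]
      intro v hv
      obtain ⟨X, hX, hvX⟩ := mem_biUnion.mp hv
      exact h.sum_share hd (card_pos.mpr ⟨X, mem_filter.mpr ⟨hX, hvX⟩⟩)
    · intro X v
      simp only [mem_filter]
      exact ⟨fun ⟨a, b⟩ => ⟨⟨a, b⟩, hsub X a b⟩, fun ⟨a, _⟩ => a⟩
  have h3 : ∑ X ∈ 𝒜, ∑ e ∈ F ∩ X.sym2, 1 / (edgeMult 𝒜 e : ℚ) ≤ #(F ∩ U.sym2) := by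
    rw [sum_comm' (t' := F ∩ U.sym2) (s' := fun e => {X ∈ 𝒜 | e ∈ X.sym2})]
    · rw [← nsmul_one, ← sum_const]
      refine sum_le_sum fun e _ => ?_
      rw [sum_const, ← edgeMult, nsmul_eq_mul, mul_one_div]
      exact div_self_le_one _
    · intro X e
      simp only [mem_filter, mem_inter]
      exact ⟨fun ⟨a, b, c⟩ => ⟨⟨a, c⟩, b, sym2_mono (hsub X a) c⟩, fun ⟨⟨a, c⟩, b, _⟩ => ⟨a, b, c⟩⟩
  have h4 := h.sparse U ((h.tight X₀ hX₀).1.trans (card_le_card (hsub X₀ hX₀)))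
  -- Sparsity of `U` falls short of `d * #U` by this binomial, so its positivity gives the
  -- contradiction.
  have h5 : 0 < (d + 1).choose 2 := Nat.choose_pos (by omega)
  rw [h2] at h1
  have h6 : d * #U ≤ #(F ∩ U.sym2) := by exact_mod_cast h1.trans h3
  omega

end HighDegreeFamily

/-! ### The rank bound for maximal sparse subgraphs -/

section RankBound

theorem inducedEdgeCount_eq {V : Type*} [DecidableEq V] (H : SimpleGraph V) {F : Finset (Sym2 V)}
    (hF : (F : Set (Sym2 V)) = H.edgeSet)
    (X : Finset V) : inducedEdgeCount H X = #(F ∩ X.sym2) := by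
  rw [inducedEdgeCount, ← hF, ← Set.ncard_coe_finset]
  congr 1
  ext e
  simp only [Set.mem_ofPred_eq, mem_coe, mem_inter, mem_sym2_iff]

theorem IsSparse.sparseEdges {V : Type*} [DecidableEq V] {d : ℕ} {H : SimpleGraph V}
    (hH : IsSparse d H) {F : Finset (Sym2 V)}
    (hF : (F : Set (Sym2 V)) = H.edgeSet) : SparseEdges d F := by
  intro X hX
  have := hH X hX
  rw [inducedEdgeCount_eq H hF] at this
  zify
  linarith

/-- An edge which cannot be added to a sparse graph is induced by a tight set. -/
theorem IsMaximalSparseSubgraph.exists_tightSet {V : Type*} [DecidableEq V] {d : ℕ}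
    {G H : SimpleGraph V}
    (hH : IsMaximalSparseSubgraph d G H) {F : Finset (Sym2 V)}
    (hF : (F : Set (Sym2 V)) = H.edgeSet) {e : Sym2 V} (he : e ∈ G.edgeSet) (heF : e ∉ F) :
    ∃ X, TightSet d F X ∧ e ∈ X.sym2 := by
  set L : SimpleGraph V := SimpleGraph.fromEdgeSet (insert e H.edgeSet) with hL
  have hLedge : L.edgeSet = ((insert e F : Finset (Sym2 V)) : Set (Sym2 V)) := by
    rw [hL, SimpleGraph.edgeSet_fromEdgeSet, coe_insert, hF]
    refine Set.Subset.antisymm Set.sdiff_subset fun f hf => ⟨hf, ?_⟩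
    rcases hf with rfl | hf
    · exact G.not_isDiag_of_mem_edgeSet he
    · exact H.not_isDiag_of_mem_edgeSet hf
  have hHL : H ≤ L := by
    rw [← SimpleGraph.edgeSet_subset_edgeSet, hLedge, ← hF]
    exact coe_subset.mpr (subset_insert _ _)
  have hLG : L ≤ G := by
    rw [← SimpleGraph.edgeSet_subset_edgeSet, hLedge, coe_insert, hF]
    exact Set.insert_subset he (SimpleGraph.edgeSet_subset_edgeSet.mpr hH.prop.1)
  have hL' : ¬ IsSparse d L := by
    intro hsp
    have h1 : L ≤ H := hH.le_of_ge ⟨hLG, hsp⟩ hHL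
    have h2 : e ∈ L.edgeSet := by rw [hLedge]; simp
    have h3 := SimpleGraph.edgeSet_subset_edgeSet.mpr h1 h2
    rw [← hF] at h3
    exact heF h3
  simp only [IsSparse, not_forall, not_le] at hL'
  obtain ⟨X, hX, hlt⟩ := hL'
  rw [inducedEdgeCount_eq L hLedge.symm] at hlt
  have hsp := hH.prop.2.sparseEdges hF X hX
  zify at hsp
  by_cases heX : e ∈ X.sym2
  · refine ⟨X, ⟨hX, ?_⟩, heX⟩
    rw [insert_inter_of_mem heX] at hlt
    have := card_insert_le e (F ∩ X.sym2)
    zify at this ⊢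
    linarith
  · rw [insert_inter_of_notMem heX] at hlt
    linarith

variable {V : Type*} [Fintype V] [DecidableEq V] {d : ℕ} {K : Type*} [Field K]
  {p : V → Fin d → K}

/-- If all sets of shared edges were dependent, the degree criterion would fail on some `Y` for each
member, producing a nonempty `HighDegreeFamily`. -/
theorem exists_linearIndepOn_sharedEdges (hp : InGeneralPosition p) (hd1 : 1 ≤ d) (hd5 : d ≤ 5)
    {F : Finset (Sym2 V)} (hF : ∀ e ∈ F, ¬ e.IsDiag) (hsp : SparseEdges d F)
    {𝒜 : Finset (Finset V)} (h𝒜 : ∀ X ∈ 𝒜, TightSet d F X)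
    (hpair : ∀ X ∈ 𝒜, ∀ Z ∈ 𝒜, X ≠ Z → #(X ∩ Z) < d) (hne : 𝒜.Nonempty) :
    ∃ X ∈ 𝒜, LinearIndepOn K (edgeRow p) (sharedEdges 𝒜 F X : Set (Sym2 V)) := by
  by_contra! hdep
  have hY : ∀ X, ∃ Y : Finset V, X ∈ 𝒜 → Y.Nonempty ∧
      ∀ v ∈ Y, d < #{e ∈ sharedEdges 𝒜 F X ∩ Y.sym2 | v ∈ e} := by
    intro X
    by_cases hX : X ∈ 𝒜
    · by_contra! hcon
      refine hdep X hX (linearIndepOn_edgeRow hp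
        (fun e he => hF e (mem_inter.mp (mem_filter.mp he).1).1) fun Y hY => ?_)
      exact (hcon Y).2 hY
    · exact ⟨∅, fun h => absurd h hX⟩
  choose Y hY using hY
  have hfam : HighDegreeFamily d F 𝒜 Y :=
    ⟨hF, hsp, h𝒜, hpair, fun X hX => (hY X hX).1, fun X hX => (hY X hX).2⟩
  exact hne.ne_empty (hfam.eq_empty hd1 hd5)

variable [CharZero K]

theorem rowRank_biUnion_sym2_le (hp : InGeneralPosition p) (hd1 : 1 ≤ d) (hd5 : d ≤ 5)
    {F : Finset (Sym2 V)} (hF : ∀ e ∈ F, ¬ e.IsDiag) (hsp : SparseEdges d F)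
    (𝒜 : Finset (Finset V)) (h𝒜 : ∀ X ∈ 𝒜, TightSet d F X)
    (hpair : ∀ X ∈ 𝒜, ∀ Z ∈ 𝒜, X ≠ Z → #(X ∩ Z) < d) :
    rowRank p (𝒜.biUnion Finset.sym2 : Finset (Sym2 V)) ≤ #(F ∩ 𝒜.biUnion Finset.sym2) := by
  induction 𝒜 using Finset.strongInduction with
  | H 𝒜 ih =>
    rcases 𝒜.eq_empty_or_nonempty with rfl | hne
    · exact (rowRank_le_card p _).trans (by simp)
    obtain ⟨X, hX, hind⟩ := exists_linearIndepOn_sharedEdges hp hd1 hd5 hF hsp h𝒜 hpair hne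
    set S := (𝒜.erase X).biUnion Finset.sym2 with hS
    have hrec : rowRank p (S : Set (Sym2 V)) ≤ #(F ∩ S) :=
      ih _ (erase_ssubset hX) (fun Z hZ => h𝒜 Z (mem_of_mem_erase hZ))
        fun Z hZ W hW => hpair Z (mem_of_mem_erase hZ) W (mem_of_mem_erase hW)
    have hunion : 𝒜.biUnion Finset.sym2 = S ∪ X.sym2 := by
      conv_lhs => rw [← insert_erase hX, biUnion_insert]
      rw [union_comm]
    have hshared : sharedEdges 𝒜 F X = F ∩ S ∩ (F ∩ X.sym2) := by
      ext e
      simp only [sharedEdges, mem_filter, mem_inter, hS, mem_biUnion, mem_erase]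
      constructor
      · rintro ⟨⟨h1, h2⟩, Z, hZ, hZX, heZ⟩
        exact ⟨⟨h1, Z, ⟨hZX, hZ⟩, heZ⟩, h1, h2⟩
      · rintro ⟨⟨h1, Z, ⟨hZX, hZ⟩, heZ⟩, -, h2⟩
        exact ⟨⟨h1, h2⟩, Z, hZ, hZX, heZ⟩
    have h1 := rowRank_union_add_rowRank_inter_le p (S : Set (Sym2 V)) (X.sym2 : Set (Sym2 V))
    have h2 := rowRank_sym2_add_choose hp (h𝒜 X hX).1
    have h3 := (h𝒜 X hX).2
    -- The shared edges are independent and lie in both parts, so the rank lost by submodularity is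
    -- at least the number of edges of `F` counted twice.
    have h4 : #(F ∩ S ∩ (F ∩ X.sym2)) ≤ rowRank p (S ∩ X.sym2 : Set (Sym2 V)) := by
      rw [← hshared, ← rowRank_eq_card hind]
      apply rowRank_mono
      rw [hshared, ← coe_inter, coe_subset]
      exact inter_subset_inter inter_subset_right inter_subset_right
    have h5 := card_union_add_card_inter (F ∩ S) (F ∩ X.sym2)
    rw [← inter_union_distrib_left] at h5
    rw [hunion, coe_union]
    omega

theorem rowRank_edgeSet_le (hp : InGeneralPosition p) (hd1 : 1 ≤ d) (hd5 : d ≤ 5)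
    {G H : SimpleGraph V} (hH : IsMaximalSparseSubgraph d G H) :
    rowRank p G.edgeSet ≤ H.edgeSet.ncard := by
  classical
  set F := H.edgeSet.toFinset with hFdef
  have hF : (F : Set (Sym2 V)) = H.edgeSet := Set.coe_toFinset _
  have hsp := hH.prop.2.sparseEdges hF
  have hdiag : ∀ e ∈ F, ¬ e.IsDiag := fun e he =>
    H.not_isDiag_of_mem_edgeSet (by rw [← hF]; exact he)
  set 𝒜 : Finset (Finset V) := {X | Maximal (TightSet d F) X} with h𝒜
  have hmax : ∀ X ∈ 𝒜, Maximal (TightSet d F) X := fun X hX => (mem_filter.mp hX).2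
  have hpair : ∀ X ∈ 𝒜, ∀ Z ∈ 𝒜, X ≠ Z → #(X ∩ Z) < d := by
    intro X hX Z hZ hXZ
    by_contra! hlt
    have hU := TightSet.union hsp (hmax X hX).prop (hmax Z hZ).prop hlt
    have h1 := (hmax X hX).eq_of_le hU subset_union_left
    have h2 := (hmax Z hZ).eq_of_le hU subset_union_right
    exact hXZ (h1.trans h2.symm)
  set S := 𝒜.biUnion Finset.sym2 with hS
  have hbound : rowRank p (S : Set (Sym2 V)) ≤ #(F ∩ S) :=
    rowRank_biUnion_sym2_le hp hd1 hd5 hdiag hsp 𝒜 (fun X hX => (hmax X hX).prop) hpair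
  have hcover : G.edgeSet ⊆ ((F \ S : Finset (Sym2 V)) : Set (Sym2 V)) ∪ (S : Set (Sym2 V)) := by
    intro e he
    by_cases heS : e ∈ S
    · exact .inr heS
    · refine .inl (mem_coe.mpr (mem_sdiff.mpr ⟨?_, heS⟩))
      by_contra heF
      obtain ⟨X, hX, heX⟩ := hH.exists_tightSet hF he heF
      obtain ⟨Z, hXZ, hZ⟩ := (Set.toFinite {X | TightSet d F X}).exists_le_maximal hX
      exact heS (mem_biUnion.mpr ⟨Z, mem_filter.mpr ⟨mem_univ _, hZ⟩, sym2_mono hXZ heX⟩)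
  have h1 := rowRank_mono p hcover
  have h2 := rowRank_union_add_rowRank_inter_le p ((F \ S : Finset (Sym2 V)) : Set (Sym2 V)) S
  have h3 := rowRank_le_card p (F \ S)
  have h4 := card_sdiff_add_card_inter F S
  rw [← hF, Set.ncard_coe_finset]
  omega

end RankBound

open Filter Topology

/-! ### Curves in fibres, by the implicit function theorem -/

section ImplicitCurves

/-- Through a point at which a `C^1` map has a surjective derivative there passes, in every
direction in the kernel of the derivative, a `C^1` curve along which the map is constant. -/
theorem exists_curve_in_fibre {E F : Type*} [NormedAddCommGroup E] [NormedSpace ℝ E]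
    [CompleteSpace E] [NormedAddCommGroup F] [NormedSpace ℝ F] [FiniteDimensional ℝ F]
    {f : E → F} {a : E} (hf : ContDiff ℝ 1 f) (hsurj : (fderiv ℝ f a).range = ⊤) {w : E}
    (hw : fderiv ℝ f a w = 0) :
    ∃ γ : ℝ → E, γ 0 = a ∧ HasDerivAt γ w 0 ∧ (∀ᶠ t in 𝓝 0, DifferentiableAt ℝ γ t) ∧
      ∀ᶠ t in 𝓝 0, f (γ t) = f a := by
  have : CompleteSpace F := FiniteDimensional.complete ℝ F
  have hstrict : HasStrictFDerivAt f (fderiv ℝ f a) a :=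
    hf.contDiffAt.hasStrictFDerivAt one_ne_zero
  have hker := (fderiv ℝ f a).ker_closedComplemented_of_finiteDimensional_range
  let φ := hstrict.implicitFunctionDataOfComplemented f (fderiv ℝ f a) hsurj hker
  let w' : (fderiv ℝ f a).ker := ⟨w, hw⟩
  let ψ := hstrict.implicitFunctionOfComplemented f (fderiv ℝ f a) hsurj hker
  let line : ℝ → (fderiv ℝ f a).ker := fun t => t • w'
  have hline : ContDiff ℝ 1 line := contDiff_id.smul contDiff_const
  have hline0 : line 0 = 0 := zero_smul _ _
  have hlined : HasDerivAt line w' 0 := by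
    simpa using (hasDerivAt_id (0 : ℝ)).smul_const w'
  refine ⟨fun t => ψ (f a) (line t), ?_, ?_, ?_, ?_⟩
  · simp only [hline0]
    exact hstrict.implicitFunctionOfComplemented_apply_image hsurj hker
  · have h1 := (hstrict.to_implicitFunctionOfComplemented hsurj hker).hasFDerivAt
    rw [← hline0] at h1
    exact h1.comp_hasDerivAt 0 hlined
  · have h1 : ContDiffAt ℝ 1 φ.implicitFunction.uncurry (φ.prodFun φ.pt) := by
      refine φ.contDiffAt_implicitFunction hf.contDiffAt ?_ one_ne_zero
      exact (ContinuousLinearMap.contDiff _).contDiffAt.comp a (contDiffAt_id.sub contDiffAt_const)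
    have h2 : φ.prodFun φ.pt = (f a, line 0) := by
      simp [φ, hline0]
    rw [h2] at h1
    have h3 := h1.comp (f := fun t : ℝ => (f a, line t)) (0 : ℝ)
      (contDiffAt_const.prodMk hline.contDiffAt)
    exact (h3.eventually (by simp)).mono fun t ht => ht.differentiableAt one_ne_zero
  · have h1 := hstrict.map_implicitFunctionOfComplemented_eq hsurj hker
    have h2 : Tendsto (fun t => (f a, line t)) (𝓝 0) (𝓝 (f a, 0)) := by
      rw [← hline0]
      exact (continuous_const.prodMk hline.continuous).tendsto 0
    exact h2.eventually h1

end ImplicitCurves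

/-! ### Squared edge lengths and their derivatives -/

section EdgeLengths

variable {V : Type*} {d : ℕ}

/-- The squared length of a pair of vertices. -/
def sqLength (x : V → Fin d → ℝ) (e : Sym2 V) : ℝ :=
  Sym2.lift ⟨fun u v => ∑ i, (x u i - x v i) ^ 2,
    fun _ _ => sum_congr rfl fun _ _ => by ring⟩ e

theorem sqLength_mk (x : V → Fin d → ℝ) (u v : V) :
    sqLength x s(u, v) = ∑ i, (x u i - x v i) ^ 2 := rfl

variable [Fintype V]

theorem contDiff_sqLength (e : Sym2 V) : ContDiff ℝ 1 fun x : V → Fin d → ℝ => sqLength x e := by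
  induction e with
  | _ u v =>
    simp only [sqLength_mk]
    fun_prop

variable [DecidableEq V]

/-- The product of a row of the rigidity matrix at `x` with a vector of velocities. -/
def edgePairing (x w : V → Fin d → ℝ) (e : Sym2 V) : ℝ :=
  ∑ vi : V × Fin d, edgeRow x e vi * w vi.1 vi.2

theorem edgePairing_mk (x w : V → Fin d → ℝ) (u v : V) :
    edgePairing x w s(u, v) = ∑ i, (x u i - x v i) * (w u i - w v i) := by
  rw [edgePairing, Fintype.sum_prod_type, sum_comm]
  refine sum_congr rfl fun i _ => ?_
  simp only [edgeRow_mk, add_mul, sum_add_distrib, ite_mul, zero_mul]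
  rw [sum_ite_eq' univ u, sum_ite_eq' univ v, if_pos (mem_univ _), if_pos (mem_univ _)]
  ring

theorem hasDerivAt_sqLength {γ : ℝ → V → Fin d → ℝ} {w : V → Fin d → ℝ} {t : ℝ}
    (h : HasDerivAt γ w t) (e : Sym2 V) :
    HasDerivAt (fun s => sqLength (γ s) e) (2 * edgePairing (γ t) w e) t := by
  induction e with
  | _ u v =>
    have hc : ∀ v i, HasDerivAt (fun s => γ s v i) (w v i) t := fun v i =>
      hasDerivAt_pi.mp (hasDerivAt_pi.mp h v) i
    simp only [sqLength_mk, edgePairing_mk, mul_sum]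
    refine HasDerivAt.fun_sum fun i _ => ?_
    convert! ((hc u i).sub (hc v i)).pow 2 using 1
    simp only [Pi.sub_apply]
    ring

theorem edgePairing_eq_zero_of_mem_span {x w : V → Fin d → ℝ} {I : Set (Sym2 V)}
    (hI : ∀ e ∈ I, edgePairing x w e = 0) {e : Sym2 V} {a : ℝ} (ha : a ≠ 0)
    (he : a • edgeRow x e ∈ Submodule.span ℝ (edgeRow x '' I)) : edgePairing x w e = 0 := by
  let φ : (V × Fin d → ℝ) →ₗ[ℝ] ℝ :=
    { toFun := fun r => ∑ vi, r vi * w vi.1 vi.2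
      map_add' := fun r s => by simp [add_mul, sum_add_distrib]
      map_smul' := fun c r => by simp [mul_sum, mul_assoc] }
  have h1 : Submodule.span ℝ (edgeRow x '' I) ≤ LinearMap.ker φ := by
    rw [Submodule.span_le]
    rintro _ ⟨f, hf, rfl⟩
    exact hI f hf
  have h2 : φ (a • edgeRow x e) = 0 := h1 he
  rw [map_smul, smul_eq_mul] at h2
  exact (mul_eq_zero.mp h2).resolve_left ha

theorem edgeRow_mem_span_of_edgePairing {x : V → Fin d → ℝ} {S : Set (Sym2 V)} {e : Sym2 V}
    (h : ∀ w : V → Fin d → ℝ, (∀ f ∈ S, edgePairing x w f = 0) → edgePairing x w e = 0) :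
    edgeRow x e ∈ Submodule.span ℝ (edgeRow x '' S) := by
  by_contra hcon
  obtain ⟨φ, hφe, hφ⟩ := Submodule.exists_le_ker_of_notMem hcon
  have hφr : ∀ f, φ (edgeRow x f) = edgePairing x (fun v i => φ (Pi.single (v, i) 1)) f := by
    intro f
    conv_lhs => rw [pi_eq_sum_univ' (edgeRow x f), map_sum]
    refine sum_congr rfl fun vi _ => ?_
    rw [map_smul, smul_eq_mul]
  refine hφe ?_
  rw [hφr]
  refine h _ fun f hf => ?_
  rw [← hφr]
  exact hφ (Submodule.subset_span ⟨f, hf, rfl⟩)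

/-- The fibre curves of the squared lengths of edges with linearly independent rows. -/
theorem exists_curve_of_edgePairing {x w : V → Fin d → ℝ} {I : Finset (Sym2 V)}
    (hI : LinearIndepOn ℝ (edgeRow x) (I : Set (Sym2 V))) (hw : ∀ e ∈ I, edgePairing x w e = 0) :
    ∃ γ : ℝ → V → Fin d → ℝ, γ 0 = x ∧ HasDerivAt γ w 0 ∧
      (∀ᶠ t in 𝓝 0, DifferentiableAt ℝ γ t) ∧
      ∀ᶠ t in 𝓝 0, ∀ e ∈ I, sqLength (γ t) e = sqLength x e := by
  let f : (V → Fin d → ℝ) → I → ℝ := fun x e => sqLength x e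
  have hf : ContDiff ℝ 1 f := contDiff_pi.mpr fun e => contDiff_sqLength (e : Sym2 V)
  have hfd : ∀ (u : V → Fin d → ℝ) (e : I), fderiv ℝ f x u e = 2 * edgePairing x u e := by
    intro u e
    have h1 : HasDerivAt (fun t : ℝ => x + t • u) u 0 := by
      simpa using ((hasDerivAt_id (0 : ℝ)).smul_const u).const_add x
    have h2 : HasFDerivAt f (fderiv ℝ f x) (x + (0 : ℝ) • u) := by
      rw [zero_smul, add_zero]
      exact (hf.differentiable one_ne_zero x).hasFDerivAt
    have h3 := hasDerivAt_pi.mp (h2.comp_hasDerivAt (0 : ℝ) h1) e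
    have h4 := hasDerivAt_sqLength h1 (e : Sym2 V)
    rw [zero_smul, add_zero] at h4
    exact h3.unique h4
  -- A nonzero functional vanishing on the range would be a nontrivial linear relation between the
  -- rows of `I`.
  have hsurj : (fderiv ℝ f x).range = ⊤ := by
    by_contra hne
    obtain ⟨φ, hφ0, hφ⟩ := Submodule.exists_le_ker_of_lt_top _ (lt_top_iff_ne_top.mpr hne)
    let c : I → ℝ := fun e => φ (Pi.single e 1)
    have hφc : ∀ y, φ y = ∑ e, y e * c e := by
      intro y
      conv_lhs => rw [pi_eq_sum_univ' y, map_sum]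
      refine sum_congr rfl fun e _ => ?_
      rw [map_smul, smul_eq_mul]
    have hsum : ∑ e : I, c e • edgeRow x (e : Sym2 V) = 0 := by
      ext vi
      have h1 := hφ (LinearMap.mem_range_self (fderiv ℝ f x).toLinearMap
        (fun v i => if (v, i) = vi then 1 else 0))
      rw [LinearMap.mem_ker, hφc] at h1
      simp only [ContinuousLinearMap.coe_coe, hfd] at h1
      have h2 : ∀ e : Sym2 V, edgePairing x (fun v i => if (v, i) = vi then 1 else 0) e =
          edgeRow x e vi := by
        intro e
        simp [edgePairing]
      simp only [h2] at h1
      simp only [Finset.sum_apply, Pi.smul_apply, smul_eq_mul, Pi.zero_apply]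
      have h3 : (2 : ℝ) * ∑ e : I, c e * edgeRow x (e : Sym2 V) vi = 0 := by
        rw [← h1, mul_sum]
        exact sum_congr rfl fun e _ => by ring
      linarith
    have hc := Fintype.linearIndependent_iff.mp hI c hsum
    apply hφ0
    ext y
    simp [hφc, hc]
  have hker : fderiv ℝ f x w = 0 := by
    ext e
    rw [hfd, hw e e.2, mul_zero, Pi.zero_apply]
  obtain ⟨γ, h0, hd, hdiff, hfib⟩ := exists_curve_in_fibre hf hsurj hker
  exact ⟨γ, h0, hd, hdiff, hfib.mono fun t ht e he => congrFun ht ⟨e, he⟩⟩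

end EdgeLengths

/-! ### Moving independence and dependence between coefficient rings -/

section Specialisation

theorem algebraicIndependent_indeterminatePlacement (V : Type*) (d : ℕ) :
    AlgebraicIndependent ℚ (fun vi : V × Fin d => indeterminatePlacement V d vi.1 vi.2) := by
  have h := MvPolynomial.algebraicIndependent_X (V × Fin d) ℚ
  exact h.map' (f := IsScalarTower.toAlgHom ℚ (MvPolynomial (V × Fin d) ℚ) (CoordField V d))
    (IsFractionRing.injective _ _)

variable {V : Type*} [DecidableEq V] {d : ℕ}

theorem edgeRow_map {R S : Type*} [CommRing R] [CommRing S] (φ : R →+* S) (x : V → Fin d → R)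
    (e : Sym2 V) : edgeRow (fun v i => φ (x v i)) e = φ ∘ edgeRow x e := by
  ext ⟨w, i⟩
  induction e with
  | _ a b => simp [edgeRow_mk, apply_ite φ]

theorem comp_mem_span_edgeRow {R S : Type*} [CommRing R] [CommRing S] (φ : R →+* S)
    {x : V → Fin d → R} {I : Set (Sym2 V)} {r : V × Fin d → R}
    (hr : r ∈ Submodule.span R (edgeRow x '' I)) :
    φ ∘ r ∈ Submodule.span S (edgeRow (fun v i => φ (x v i)) '' I) := by
  induction hr using Submodule.span_induction with
  | mem r hr =>
    obtain ⟨e, he, rfl⟩ := hr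
    exact Submodule.subset_span ⟨e, he, edgeRow_map φ x e⟩
  | zero =>
    convert! Submodule.zero_mem _
    ext
    simp
  | add r s _ _ hr hs =>
    convert! Submodule.add_mem _ hr hs
    ext
    simp
  | smul c r _ hr =>
    convert! Submodule.smul_mem _ (φ c) hr
    ext
    simp

/-- The placement whose coordinates are the indeterminates of a polynomial ring. -/
noncomputable def polynomialPlacement (V : Type*) (d : ℕ) :
    V → Fin d → MvPolynomial (V × Fin d) ℚ :=
  fun v i => MvPolynomial.X (v, i)

theorem linearIndepOn_edgeRow_map [Finite V] {R S : Type*} [CommRing R] [CommRing S] [IsDomain S]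
    (φ : R →+* S) (hφ : Function.Injective φ) {x : V → Fin d → R} {I : Set (Sym2 V)}
    (hI : LinearIndepOn R (edgeRow x) I) :
    LinearIndepOn S (edgeRow fun v i => φ (x v i)) I := by
  let := φ.toAlgebra
  have : FaithfulSMul R S := (faithfulSMul_iff_algebraMap_injective R S).mpr hφ
  have h := (linearIndependent_algebraMap_comp_iff (S := S)).mpr hI
  have hmap : (edgeRow fun v i => φ (x v i)) = fun e => φ ∘ edgeRow x e :=
    funext (edgeRow_map φ x)
  rw [hmap]
  exact h

/-- Over a ring a maximal independent set spans the rest only up to nonzero multiples. With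
polynomial coefficients such a relation can be evaluated at every placement, and is useful wherever
the multiplier does not vanish. -/
theorem exists_linearIndepOn_smul_mem_span {ι R M : Type*} [Finite ι] [CommRing R] [Nontrivial R]
    [AddCommGroup M] [Module R M] (v : ι → M) (E : Set ι) :
    ∃ I : Finset ι, (I : Set ι) ⊆ E ∧ LinearIndepOn R v I ∧
      ∀ e ∈ E, ∃ a : R, a ≠ 0 ∧ a • v e ∈ Submodule.span R (v '' I) := by
  classical
  obtain ⟨s, hs, hspan⟩ := exists_maximal_linearIndepOn R (fun e : E => v e)
  have hfin : (Subtype.val '' s : Set ι).Finite := Set.toFinite _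
  refine ⟨hfin.toFinset, ?_, ?_, ?_⟩
  · rw [Set.Finite.coe_toFinset]
    rintro _ ⟨e, -, rfl⟩
    exact e.2
  · rw [Set.Finite.coe_toFinset]
    exact LinearIndepOn.image_of_comp Subtype.val v hs
  · intro e he
    rw [Set.Finite.coe_toFinset, Set.image_image]
    by_cases h : (⟨e, he⟩ : E) ∈ s
    · refine ⟨1, one_ne_zero, ?_⟩
      rw [one_smul]
      exact Submodule.subset_span ⟨⟨e, he⟩, h, rfl⟩
    · exact hspan _ h

theorem rigidityRank_eq_rowRank [Fintype V] (G : SimpleGraph V) :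
    rigidityRank d G = rowRank (indeterminatePlacement V d) G.edgeSet := by
  rw [rigidityRank, Matrix.rank_eq_finrank_span_row, rowRank, Set.image_eq_range]
  rfl

end Specialisation

/-! ### From continuous to infinitesimal rigidity at generic placements -/

section Rigidity

variable {V : Type*} [Fintype V] [DecidableEq V] {d : ℕ}

/-- An infinitesimal motion of a rigid generic framework preserves all lengths to first order. -/
theorem IsRigid.edgePairing_eq_zero {G : SimpleGraph V} {p : V → EuclideanSpace ℝ (Fin d)}
    (hp : IsGenericPlacement p) (hrigid : IsRigid G p) {w : V → Fin d → ℝ}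
    (hw : ∀ e ∈ G.edgeSet, edgePairing (fun v i => p v i) w e = 0) (e : Sym2 V) :
    edgePairing (fun v i => p v i) w e = 0 := by
  set P : V → Fin d → ℝ := fun v i => p v i with hP
  -- The basis is taken over the polynomial ring, not at `P` alone, so that the rows of `I` span all
  -- rows of `G` at every placement near `P` as well.
  obtain ⟨I, hIG, hI, hspan⟩ := exists_linearIndepOn_smul_mem_span
    (R := MvPolynomial (V × Fin d) ℚ) (edgeRow (polynomialPlacement V d)) G.edgeSet
  let ev : (V → Fin d → ℝ) → MvPolynomial (V × Fin d) ℚ →+* ℝ := fun x =>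
    (MvPolynomial.aeval (fun vi : V × Fin d => x vi.1 vi.2)).toRingHom
  have hev : ∀ x, (fun v i => ev x (polynomialPlacement V d v i)) = x := by
    intro x
    ext v i
    exact MvPolynomial.aeval_X _ _
  have hspan' : ∀ f ∈ G.edgeSet, ∃ a : MvPolynomial (V × Fin d) ℚ, ev P a ≠ 0 ∧
      ∀ x, ev x a • edgeRow x f ∈ Submodule.span ℝ (edgeRow x '' (I : Set (Sym2 V))) := by
    intro f hf
    obtain ⟨a, ha, hmem⟩ := hspan f hf
    refine ⟨a, fun h0 => ha (hp (h0.trans (map_zero _).symm)), fun x => ?_⟩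
    have h1 := comp_mem_span_edgeRow (ev x) hmem
    rw [hev] at h1
    convert! h1 using 1
    have h2 := edgeRow_map (ev x) (polynomialPlacement V d) f
    rw [hev] at h2
    rw [h2]
    ext vi
    simp
  have hIP : LinearIndepOn ℝ (edgeRow P) (I : Set (Sym2 V)) := by
    have := linearIndepOn_edgeRow_map (ev P) hp hI
    rwa [hev] at this
  obtain ⟨γ, hγ0, hγd, hdiff, hfib⟩ :=
    exists_curve_of_edgePairing hIP fun f hf => hw f (hIG hf)
  choose! a ha hspan'' using hspan'
  have hcont : ∀ᶠ t in 𝓝 (0 : ℝ), ∀ f ∈ G.edgeSet, ev (γ t) (a f) ≠ 0 := by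
    rw [eventually_all_finite (Set.toFinite _)]
    intro f hf
    have h1 : Continuous fun x : V → Fin d → ℝ => ev x (a f) := by
      have : ∀ x : V → Fin d → ℝ, ev x (a f) =
          MvPolynomial.eval (fun vi => x vi.1 vi.2) (MvPolynomial.map (algebraMap ℚ ℝ) (a f)) := by
        intro x
        rw [MvPolynomial.eval_map]
        rfl
      simp only [this]
      refine (MvPolynomial.continuous_eval _).comp ?_
      fun_prop
    have h2 : ContinuousAt (fun t => ev (γ t) (a f)) 0 :=
      h1.continuousAt.comp hγd.continuousAt
    refine h2.eventually_ne ?_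
    rw [hγ0]
    exact ha f hf
  obtain ⟨ε, hε, hball⟩ := Metric.eventually_nhds_iff_ball.mp (hdiff.and (hfib.and hcont))
  set B := Metric.ball (0 : ℝ) ε with hB
  have h0B : (0 : ℝ) ∈ B := Metric.mem_ball_self hε
  -- The curve fixes the lengths in `I` by construction. Its velocity at each time is orthogonal to
  -- the rows of `I`, hence to every row of `G`, so all edge lengths have zero derivative.
  have hlen : ∀ f ∈ G.edgeSet, ∀ t ∈ B, sqLength (γ t) f = sqLength P f := by
    intro f hf t ht
    have hder : ∀ t ∈ B, HasDerivAt (fun s => sqLength (γ s) f) 0 t := by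
      intro t ht
      obtain ⟨h1, -, h3⟩ := hball t ht
      have h4 := h1.hasDerivAt
      have h5 : edgePairing (γ t) (deriv γ t) f = 0 := by
        refine edgePairing_eq_zero_of_mem_span ?_ (h3 f hf) (hspan'' f hf (γ t))
        intro j hj
        have h6 := hasDerivAt_sqLength h4 j
        have h7 : (fun s => sqLength (γ s) j) =ᶠ[𝓝 t] fun _ => sqLength P j :=
          (Metric.isOpen_ball.eventually_mem ht).mono fun s hs => (hball s hs).2.1 j hj
        have h8 := h6.unique ((hasDerivAt_const t (sqLength P j)).congr_of_eventuallyEq h7)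
        linarith
      have h6 := hasDerivAt_sqLength h4 f
      rwa [h5, mul_zero] at h6
    have h1 := Metric.isOpen_ball.is_const_of_deriv_eq_zero (𝕜 := ℝ)
      (convex_ball (0 : ℝ) ε).isPreconnected
      (fun t ht => (hder t ht).differentiableAt.differentiableWithinAt)
      (fun t ht => (hder t ht).deriv) ht h0B
    simp only [hγ0] at h1
    exact h1
  have hdist : ∀ (x y : V → EuclideanSpace ℝ (Fin d)) (u v : V),
      dist (x u) (x v) = dist (y u) (y v) ↔
        sqLength (fun v i => x v i) s(u, v) = sqLength (fun v i => y v i) s(u, v) := by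
    intro x y u v
    simp only [EuclideanSpace.dist_eq, sqLength_mk, Real.dist_eq, sq_abs]
    exact Real.sqrt_inj (sum_nonneg fun i _ => sq_nonneg _) (sum_nonneg fun i _ => sq_nonneg _)
  have hhalf : ∀ t ∈ Set.Icc (0 : ℝ) 1, t * (ε / 2) ∈ B := by
    intro t ht
    rw [hB, Metric.mem_ball, Real.dist_eq, sub_zero, abs_of_nonneg (by have := ht.1; positivity)]
    nlinarith [ht.2]
  -- Time is rescaled by `ε / 2` so that the whole unit interval stays inside the open ball.
  let q : unitInterval → V → EuclideanSpace ℝ (Fin d) := fun t v =>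
    WithLp.toLp 2 (γ ((t : ℝ) * (ε / 2)) v)
  have hq : Continuous q := by
    have h1 : ContinuousOn γ B := fun t ht =>
      (hball t ht).1.continuousAt.continuousWithinAt
    have h2 : Continuous fun t : unitInterval => γ ((t : ℝ) * (ε / 2)) :=
      h1.comp_continuous (by fun_prop) fun t => hhalf t t.2
    refine continuous_pi fun v => ?_
    exact (PiLp.continuous_toLp 2 _).comp ((continuous_apply v).comp h2)
  have hmotion := hrigid q hq
    (by
      ext v i
      simp [q, hγ0, hP])
    (by
      intro t u v huv
      rw [hdist]
      exact hlen s(u, v) huv _ (hhalf t t.2))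
  induction e with
  | _ u v =>
    have h1 : ∀ t ∈ Set.Icc (0 : ℝ) (ε / 2), sqLength (γ t) s(u, v) = sqLength P s(u, v) := by
      intro t ht
      have h2 : t / (ε / 2) ∈ Set.Icc (0 : ℝ) 1 :=
        ⟨div_nonneg ht.1 (by positivity), (div_le_one (by positivity)).mpr ht.2⟩
      have h3 := (hdist _ _ u v).mp (hmotion ⟨t / (ε / 2), h2⟩ u v)
      have h4 : t / (ε / 2) * (ε / 2) = t := div_mul_cancel₀ _ (by positivity)
      simpa only [q, h4] using h3
    have h2 := hasDerivAt_sqLength hγd s(u, v)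
    rw [hγ0] at h2
    have h3 : HasDerivWithinAt (fun s => sqLength (γ s) s(u, v)) 0 (Set.Icc 0 (ε / 2)) 0 :=
      (hasDerivWithinAt_const (0 : ℝ) _ (sqLength P s(u, v))).congr h1
        (h1 0 ⟨le_rfl, by positivity⟩)
    -- Lengths of arbitrary pairs are known to be constant only for `t ≥ 0`, so the derivatives are
    -- compared within the interval.
    have h4 := (uniqueDiffOn_Icc (show (0 : ℝ) < ε / 2 by positivity) 0
      ⟨le_rfl, by positivity⟩).eq_deriv _ h2.hasDerivWithinAt h3
    linarith

/-- At the generic real placement, rigidity puts every row of the complete graph in the span of the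
rows of `I`, so `I` has at least as many edges as the rank of the complete graph. Being independent
over the polynomials, `I` is also independent over the field of rational functions. -/
theorem IsGenericallyRigid.le_rigidityRank {G : SimpleGraph V} (hG : IsGenericallyRigid d G)
    (hV : d ≤ Fintype.card V) :
    d * Fintype.card V ≤ rigidityRank d G + (d + 1).choose 2 := by
  obtain ⟨p, hp, hrigid⟩ := hG
  set P : V → Fin d → ℝ := fun v i => p v i with hP
  have hgp : InGeneralPosition P := inGeneralPosition_of_algebraicIndependent hp
  have h1 := rowRank_sym2_add_choose hgp (X := univ) (by simpa using hV)
  rw [card_univ] at h1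
  obtain ⟨I, hIG, hI, hspan⟩ := exists_linearIndepOn_smul_mem_span
    (R := MvPolynomial (V × Fin d) ℚ) (edgeRow (polynomialPlacement V d)) G.edgeSet
  have h2 : rowRank P ((univ : Finset V).sym2 : Set (Sym2 V)) ≤
      rowRank P (I : Set (Sym2 V)) := by
    apply Submodule.finrank_mono
    rw [Submodule.span_le]
    rintro _ ⟨e, -, rfl⟩
    refine edgeRow_mem_span_of_edgePairing fun w hw => ?_
    refine hrigid.edgePairing_eq_zero hp ?_ e
    intro f hf
    obtain ⟨a, ha, hmem⟩ := hspan f hf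
    let φ : MvPolynomial (V × Fin d) ℚ →+* ℝ :=
      (MvPolynomial.aeval (fun vi : V × Fin d => p vi.1 vi.2)).toRingHom
    have hφ : (fun v i => φ (polynomialPlacement V d v i)) = P := by
      ext v i
      exact MvPolynomial.aeval_X _ _
    have h3 := comp_mem_span_edgeRow φ hmem
    have h4 := edgeRow_map φ (polynomialPlacement V d) f
    rw [hφ] at h3 h4
    refine edgePairing_eq_zero_of_mem_span (a := φ a) hw
      (fun h0 => ha (hp (h0.trans (map_zero _).symm))) ?_
    convert! h3 using 1
    rw [h4]
    ext vi
    simp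
  have h3 : I.card ≤ rigidityRank d G := by
    have h4 : LinearIndepOn (CoordField V d) (edgeRow (indeterminatePlacement V d))
        (I : Set (Sym2 V)) :=
      linearIndepOn_edgeRow_map (algebraMap (MvPolynomial (V × Fin d) ℚ) (CoordField V d))
        (IsFractionRing.injective _ _) hI
    rw [rigidityRank_eq_rowRank, ← rowRank_eq_card h4]
    exact rowRank_mono _ hIG
  have h4 := rowRank_le_card P I
  omega

end Rigidity

end BarJoint

theorem theorem4p1 {V : Type*} [Fintype V] [DecidableEq V] (d : ℕ) (hd_pos : 1 ≤ d) (hd : d ≤ 5)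
    (G H : SimpleGraph V) (hH : BarJoint.IsMaximalSparseSubgraph d G H) :
    BarJoint.rigidityRank d G ≤ H.edgeSet.ncard ∧
      (d ≤ Fintype.card V → BarJoint.IsGenericallyRigid d G →
        (H.edgeSet.ncard : ℤ) = (d : ℤ) * (Fintype.card V : ℤ) - ((d + 1).choose 2 : ℤ)) := by
  have hle : BarJoint.rigidityRank d G ≤ H.edgeSet.ncard := by
    rw [BarJoint.rigidityRank_eq_rowRank]
    exact BarJoint.rowRank_edgeSet_le (BarJoint.inGeneralPosition_of_algebraicIndependent
      (BarJoint.algebraicIndependent_indeterminatePlacement V d)) hd_pos hd hH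
  refine ⟨hle, fun hV hG => ?_⟩
  have h1 := hG.le_rigidityRank hV
  have h2 := hH.prop.2 Finset.univ (by simpa using hV)
  have h3 : BarJoint.inducedEdgeCount H Finset.univ = H.edgeSet.ncard := by
    simp [BarJoint.inducedEdgeCount]
  rw [h3, Finset.card_univ] at h2
  zify at h1 hle
  linarith
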